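/- **Setting.** For a real square matrix $A$ put $\mathcal D_A f(\mathbf x)=f'(\mathbf x)A\mathbf x$ on polynomials and formal power series. Let $(X_1,Y_1,Z_1)$ be an $\mathfrak{sl}_2$ triad of real $n\times n$ matrices and $(X_2,Y_2,Z_2)$ one of real $m\times m$ matrices ($[X,Y]=Z$, $[Z,X]=2X$, $[Z,Y]=-2Y$), acting on the variables $\mathbf x\in\mathbb R^n$ and $\mathbf y\in\mathbb R^m$ respectively, and let $(X,Y,Z)$ be the block-diagonal triad $X=\mathrm{diag}(X_1,X_2)$, $Y=\mathrm{diag}(Y_1,Y_2)$, $Z=\mathrm{diag}(Z_1,Z_2)$ acting on $(\mathbf x,\mathbf y)$. Let $\mathcal J_1=\ker\mathcal D_{Y_1}\subset\mathbb R[[\mathbf x]]$, $\mathcal J_2=\ker\mathcal D_{Y_2}\subset\mathbb R[[\mathbf y]]$ and $\mathcal J=\ker\mathcal D_Y\subset\mathbb R[[\mathbf x,\mathbf y]]$ be the algebras of formal invariants. A *weight invariant* $f$ is a nonzero polynomial in the kernel of $\mathcal D_Y$ (for the relevant triad) with $\mathcal D_Zf=\widehat f f$; its *weight* $\widehat f$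 is then a nonnegative integer. A *Hilbert basis* of such an algebra is a finite ordered set of homogeneous weight invariants such that every formal invariant is a (countable, formal) linear combination of monomials in them. Let $\alpha=(\alpha_1,\dots,\alpha_p)$ and $\beta=(\beta_1,\dots,\beta_q)$ be Hilbert bases of $\mathcal J_1$ and $\mathcal J_2$. Let $A_1$ and $A_2$ be standard preferred sets of monomials in $\alpha$ and in $\beta$. Here *preferred* means that the monomials in the set are linearly independent and every formal invariant is a countable linear combination of them. *Standard* means that, as a set of monomials in indeterminates $t_1,t_2,\dots$, it is the set of monomials not in some monomial ideal. Let the *transvectant cone* be $$\mathcal C=\Big\{(\mathbf k;\boldsymbol\ell;s)\in\mathbb N^{p+q+1}: s\le\sum_i\widehat{\alpha}_ik_i,\ s\le\sum_j\widehat{\beta}_j\ell_j\Big\},$$ let $\mathcal C^*$ be the set of $(\mathbf k;\boldsymbol\ell;s)\in\mathcal C$ with $\alpha^{\mathbf k}\in A_1$ and $\beta^{\boldsymbol\ell}\in A_2$, let $\Pi$ be the set of *primes* of $\mathcal C$ (nonzero elements that are not the sum of two nonzero elements of $\mathcal C$), and let $\Pi^*=\Pi\cap\mathcal C^*$ be the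 set of *admissible primes*. For $(\mathbf k;\boldsymbol\ell;s)\in\mathcal C$ let $\mathbb T(\mathbf k;\boldsymbol\ell;s)=(f,g)^{(s)}$ with $f=\alpha^{\mathbf k}$, $g=\beta^{\boldsymbol\ell}$, where $$(f,g)^{(s)}=\sum_{j=0}^{s}(-1)^j\binom sj\frac{(\widehat f-j)!}{(\widehat f-s)!}\frac{(\widehat g-s+j)!}{(\widehat g-s)!}\,(\mathcal D_{X_1}^{\,j}f)(\mathcal D_{X_2}^{\,s-j}g)\in\mathbb R[\mathbf x,\mathbf y].$$ **Theorem 11.7.** The set $\Pi^*$ is finite and is a weak spanning set for $\mathcal C^*$: $\Pi^*\subseteq\mathcal C^*$, and every element of $\mathcal C^*$ is a finite sum (repetitions allowed) of elements of $\Pi^*$. Moreover, for every enumeration $\Pi^*=\{\pi_1,\dots,\pi_t\}$ without repetitions, the admissible prime transvectants $\vartheta_i=\mathbb T(\pi_i)$ are pairwise distinct and $\vartheta=(\vartheta_1,\dots,\vartheta_t)$ is a Hilbert basis for $\mathcal J$. -/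

import Mathlib

namespace BoxProduct

noncomputable section

/-- An `sl₂` triad of real square matrices: `[X, Y] = Z`, `[Z, X] = 2X`, `[Z, Y] = -2Y`, where
`[A, B] = AB - BA`. The zero triad is allowed. -/
structure IsTriad {σ : Type*} [Fintype σ] (X Y Z : Matrix σ σ ℝ) : Prop where
  lie_X_Y : X * Y - Y * X = Z
  lie_Z_X : Z * X - X * Z = (2 : ℝ) • X
  lie_Z_Y : Z * Y - Y * Z = (-2 : ℝ) • Y

/-- The directional derivative `(𝒟_A f)(x) = f'(x) A x = ∑ᵢ (A x)ᵢ ∂f/∂xᵢ` on polynomials. -/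
def polyD {σ : Type*} [Fintype σ] (A : Matrix σ σ ℝ) :
    Derivation ℝ (MvPolynomial σ ℝ) (MvPolynomial σ ℝ) :=
  ∑ i, (∑ j, MvPolynomial.C (A i j) * MvPolynomial.X j) • MvPolynomial.pderiv i

/-- The directional derivative `(𝒟_A f)(x) = f'(x) A x = ∑ᵢ (A x)ᵢ ∂f/∂xᵢ` on formal power
series. -/
def formalD {σ : Type*} [Fintype σ] (A : Matrix σ σ ℝ) :
    Derivation ℝ (MvPowerSeries σ ℝ) (MvPowerSeries σ ℝ) :=
  ∑ i, (∑ j, MvPowerSeries.C (A i j) * MvPowerSeries.X j) • MvPowerSeries.pderiv ℝ i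

/-- The algebra `𝒥 = ker 𝒳 ⊆ ℝ[[x]]` of formal invariants, where `𝒳 = 𝒟_Y`. -/
def formalInvariants {σ : Type*} [Fintype σ] (Y : Matrix σ σ ℝ) : Set (MvPowerSeries σ ℝ) :=
  {f | formalD Y f = 0}

/-- A polynomial weight invariant of the triad `(𝒳, 𝒴, 𝒵) = (𝒟_Y, 𝒟_X, 𝒟_Z)`: an eigenvector of
`𝒵` (in particular nonzero) that is annihilated by `𝒳`. -/
structure IsWeightInvariant {σ : Type*} [Fintype σ] (Y Z : Matrix σ σ ℝ)
    (f : MvPolynomial σ ℝ) : Prop where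
  ne_zero : f ≠ 0
  invariant : polyD Y f = 0
  eigenvector : ∃ w : ℝ, polyD Z f = w • f

/-- The weight `f̂`, given by `𝒵 f = f̂ f`. The `𝒵`-eigenvalue of a (polynomial) weight invariant of
a triad is always a nonnegative integer, and it is unique since `f ≠ 0`; the value of `weight` on
other polynomials is irrelevant. -/
def weight {σ : Type*} [Fintype σ] (Z : Matrix σ σ ℝ) (f : MvPolynomial σ ℝ) : ℕ :=
  sInf {w : ℕ | polyD Z f = (w : ℝ) • f}

/-- The monomial `α^k = α₁^{k₁} ⋯ α_p^{k_p}`, as a polynomial in the original variables. -/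
def mono {σ : Type*} {p : ℕ} (α : Fin p → MvPolynomial σ ℝ) (k : Fin p →₀ ℕ) :
    MvPolynomial σ ℝ :=
  ∏ i, α i ^ k i

/-- `f` is the formal (possibly infinite) linear combination `∑ᵢ cᵢ gᵢ`: every monomial in the
variables occurs in only finitely many of the terms `cᵢ gᵢ`, and its coefficients there add up to
its coefficient in `f`. -/
def IsFormalCombination {σ ι : Type*} (g : ι → MvPolynomial σ ℝ) (c : ι → ℝ)
    (f : MvPowerSeries σ ℝ) : Prop :=
  ∀ e : σ →₀ ℕ, {i | c i * MvPolynomial.coeff e (g i) ≠ 0}.Finite ∧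
    ∑ᶠ i, c i * MvPolynomial.coeff e (g i) = MvPowerSeries.coeff e f

/-- `α = (α₁, …, α_p)` is a Hilbert basis for the algebra `𝒥 = ker 𝒟_Y` of formal invariants: each
`αᵢ` is a homogeneous weight invariant, and every formal invariant is a (countable) linear
combination of the monomials `α^k`, `k ∈ ℕ^p`. -/
structure IsHilbertBasis {σ : Type*} [Fintype σ] (Y Z : Matrix σ σ ℝ) {p : ℕ}
    (α : Fin p → MvPolynomial σ ℝ) : Prop where
  weightInvariant : ∀ i, IsWeightInvariant Y Z (α i)
  homogeneous : ∀ i, ∃ d : ℕ, (α i).IsHomogeneous d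
  spans : ∀ f ∈ formalInvariants Y, ∃ c : (Fin p →₀ ℕ) → ℝ, IsFormalCombination (mono α) c f

/-- A set `A` of monomials `t^k` (given by their exponents `k`) in `ℝ[t₁, …, t_p]` is standard if it
consists of the monomials that do not lie in some monomial ideal `I`, i.e. an ideal generated by a
set of monomials. -/
def IsStandard {p : ℕ} (A : Set (Fin p →₀ ℕ)) : Prop :=
  ∃ (G : Set (Fin p →₀ ℕ)) (I : Ideal (MvPolynomial (Fin p) ℝ)),
    I = Ideal.span ((fun k => MvPolynomial.monomial k (1 : ℝ)) '' G) ∧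
      A = {k | MvPolynomial.monomial k (1 : ℝ) ∉ I}

/-- `A` (a set of exponents `k ∈ ℕ^p`, standing for the monomials `α^k`) is a preferred set for
`ker 𝒟_Y`: the `α^k`, `k ∈ A`, form a formal vector space basis of `ker 𝒟_Y`, i.e. they are
linearly independent and every formal invariant is a countable linear combination of them. -/
structure IsPreferred {σ : Type*} [Fintype σ] (Y : Matrix σ σ ℝ) {p : ℕ}
    (α : Fin p → MvPolynomial σ ℝ) (A : Set (Fin p →₀ ℕ)) : Prop where
  linearIndependent : LinearIndependent ℝ (fun k : A => mono α k)
  spans : ∀ f ∈ formalInvariants Y,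
    ∃ c : A → ℝ, IsFormalCombination (fun k : A => mono α k) c f

/-- The external transvectant `(f, g)^{(s)}` of `f ∈ ℝ[x]` and `g ∈ ℝ[y]`,
`∑_{j=0}^s (-1)^j W (𝒴₁^j f) (𝒴₂^{s-j} g) ∈ ℝ[x, y]`,
`W = binom(s, j) · (f̂ - j)! / (f̂ - s)! · (ĝ - s + j)! / (ĝ - s)!`,
where `𝒴₁ = 𝒟_{X₁}`, `𝒴₂ = 𝒟_{X₂}`. It is meaningful for weight invariants `f`, `g` and
`s ≤ f̂`, `s ≤ ĝ`. -/
def transvectant {σ τ : Type*} [Fintype σ] [Fintype τ]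
    (X₁ Z₁ : Matrix σ σ ℝ) (X₂ Z₂ : Matrix τ τ ℝ)
    (f : MvPolynomial σ ℝ) (g : MvPolynomial τ ℝ) (s : ℕ) : MvPolynomial (σ ⊕ τ) ℝ :=
  ∑ j ∈ Finset.range (s + 1),
    ((-1 : ℝ) ^ j * ((s.choose j : ℝ)
        * (((weight Z₁ f - j).factorial : ℝ) / ((weight Z₁ f - s).factorial : ℝ))
        * (((weight Z₂ g - s + j).factorial : ℝ) / ((weight Z₂ g - s).factorial : ℝ)))) •
      (MvPolynomial.rename Sum.inl ((polyD X₁)^[j] f)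
        * MvPolynomial.rename Sum.inr ((polyD X₂)^[s - j] g))

/-- Integer vectors `(k; ℓ; s) ∈ ℕ^{p+q+1}`. -/
abbrev Vec (p q : ℕ) : Type := (Fin p →₀ ℕ) × (Fin q →₀ ℕ) × ℕ

/-- The transvectant cone `𝒞 = 𝒞(α, β)`: the integer vectors `(k; ℓ; s)` with
`0 ≤ s ≤ α̂₁ k₁ + ⋯ + α̂_p k_p` and `0 ≤ s ≤ β̂₁ ℓ₁ + ⋯ + β̂_q ℓ_q`. -/
def cone {σ τ : Type*} [Fintype σ] [Fintype τ] (Z₁ : Matrix σ σ ℝ) (Z₂ : Matrix τ τ ℝ) {p q : ℕ}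
    (α : Fin p → MvPolynomial σ ℝ) (β : Fin q → MvPolynomial τ ℝ) : Set (Vec p q) :=
  {v | v.2.2 ≤ ∑ i, weight Z₁ (α i) * v.1 i ∧ v.2.2 ≤ ∑ j, weight Z₂ (β j) * v.2.1 j}

/-- The admissible part of a set of integer vectors: those `(k; ℓ; s)` with `α^k` and `β^ℓ` in the
given preferred sets. For the cone `𝒞` this is `𝒞*`. -/
def admissiblePart {p q : ℕ} (A₁ : Set (Fin p →₀ ℕ)) (A₂ : Set (Fin q →₀ ℕ))
    (S : Set (Vec p q)) : Set (Vec p q) :=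
  {v ∈ S | v.1 ∈ A₁ ∧ v.2.1 ∈ A₂}

/-- The primes of a set `S` of integer vectors: the nonzero elements that are not the sum of two
nonzero elements of `S`. -/
def primes {p q : ℕ} (S : Set (Vec p q)) : Set (Vec p q) :=
  {v ∈ S | v ≠ 0 ∧ ∀ a ∈ S, ∀ b ∈ S, v = a + b → a = 0 ∨ b = 0}

/-- `P` is a weak spanning set for `S`: it is a subset of `S`, and every element of `S` is a finite
sum (repetitions allowed) of elements of `P`. -/
def IsWeakSpanningSet {p q : ℕ} (P S : Set (Vec p q)) : Prop :=
  P ⊆ S ∧ ∀ v ∈ S, ∃ m : Multiset (Vec p q), (∀ a ∈ m, a ∈ P) ∧ m.sum = v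

/-- The transvectant map `𝕋(k; ℓ; s) = (α^k, β^ℓ)^{(s)}`. -/
def transvectantMap {σ τ : Type*} [Fintype σ] [Fintype τ]
    (X₁ Z₁ : Matrix σ σ ℝ) (X₂ Z₂ : Matrix τ τ ℝ) {p q : ℕ}
    (α : Fin p → MvPolynomial σ ℝ) (β : Fin q → MvPolynomial τ ℝ) (v : Vec p q) :
    MvPolynomial (σ ⊕ τ) ℝ :=
  transvectant X₁ Z₁ X₂ Z₂ (mono α v.1) (mono β v.2.1) v.2.2

/-- The block diagonal matrix of the output setting on the variables `(x, y)`. -/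
abbrev blockDiag {σ τ : Type*} (M₁ : Matrix σ σ ℝ) (M₂ : Matrix τ τ ℝ) :
    Matrix (σ ⊕ τ) (σ ⊕ τ) ℝ :=
  Matrix.fromBlocks M₁ 0 0 M₂

end

end BoxProduct

open BoxProduct

/-! Write `D₁`, `D₂` for the derivations `polyD` of `diag(Y₁, 0)` and `diag(0, Y₂)`. They commute,
and on an invariant `R` of `diag(Y₁, Y₂)` one has `D₂ = -D₁`. If `s` is the largest order with `D₁^s
R ≠ 0`, then `D₁^s R`, the leading term of `R`, is killed by both derivations. It therefore lies in
`ker D_{Y₁} ⊗ ker D_{Y₂}` and expands uniquely in the products `α^k β^ℓ` with `k ∈ A₁`, `ℓ ∈ A₂`.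

Two facts make this a filtration argument. By `sl₂` theory an `s`-th raising that ends in highest
weight vectors has no component of weight below `s`; used in each block, this puts every `(k; ℓ; s)`
that occurs into the cone (`exists_leading_expansion`). Conversely, for `(k; ℓ; s)` in the cone the
transvectant has order `s` and leading term a nonzero multiple of `α^k β^ℓ`
(`hasLeading_transvectant`).

By the Leibniz rule, orders add and leading terms multiply (`HasLeading.mul`). So when `(k; ℓ; s)`
is a sum of admissible primes, the product of their transvectants has the same order, and the same
leading term up to a scalar, as the transvectant it replaces. Subtracting such products lowers the
order, and induction on it shows that they span the polynomial invariants (`mem_span_mono`); formal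
invariants follow degree by degree. Distinctness holds because order and leading term determine `(k;
ℓ; s)`.

The combinatorial half is Dickson's lemma for the cone with slack variables (`finite_primes_cone`),
and the fact that standard sets are closed under divisors. -/

namespace BoxProduct

/-! ### Representation theory of `sl₂` without assuming finite dimension. -/

section Sl2

open Module

/-- Three endomorphisms satisfying the relations of `sl₂`. -/
structure Sl2Ops {V : Type*} [AddCommGroup V] [Module ℝ V] (E F H : End ℝ V) : Prop where
  lie_E_F : ∀ v, E (F v) = F (E v) + H v
  lie_H_E : ∀ v, H (E v) = E (H v) + (2 : ℝ) • E v
  lie_H_F : ∀ v, H (F v) = F (H v) - (2 : ℝ) • F v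

variable {V : Type*} [AddCommGroup V] [Module ℝ V] {E F H : End ℝ V}

theorem Sl2Ops.symm (h : Sl2Ops E F H) : Sl2Ops F E (-H) where
  lie_E_F v := by simp [h.lie_E_F]
  lie_H_E v := by simp [h.lie_H_F]; abel
  lie_H_F v := by simp [h.lie_H_E]; abel

theorem Sl2Ops.H_pow_E (h : Sl2Ops E F H) (m : ℕ) (v : V) :
    H ((E ^ m) v) = (E ^ m) (H v) + (2 * m : ℝ) • (E ^ m) v := by
  induction m with
  | zero => simp
  | succ m ih =>
    rw [pow_succ', Module.End.mul_apply, h.lie_H_E, ih, Module.End.mul_apply, map_add, map_smul]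
    push_cast
    module

theorem Sl2Ops.pow_E_F (h : Sl2Ops E F H) (m : ℕ) (v : V) :
    (E ^ (m + 1)) (F v) =
      F ((E ^ (m + 1)) v) + (m + 1 : ℝ) • ((E ^ m) (H v) + (m : ℝ) • (E ^ m) v) := by
  induction m with
  | zero => simp [h.lie_E_F]
  | succ m ih =>
    rw [pow_succ', Module.End.mul_apply, ih, map_add, map_smul, map_add, map_smul, h.lie_E_F,
      h.H_pow_E, ← Module.End.mul_apply E, ← Module.End.mul_apply E, ← Module.End.mul_apply E,
      ← pow_succ', ← pow_succ']
    push_cast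
    module

/-- On a highest weight vector, `E F^{m+1}` acts as a multiple of `F^m`. -/
theorem Sl2Ops.E_pow_F_of_highest (h : Sl2Ops E F H) {f : V} {w : ℝ} (hE : E f = 0)
    (hH : H f = w • f) (m : ℕ) :
    E ((F ^ (m + 1)) f) = ((m + 1) * (w - m) : ℝ) • (F ^ m) f := by
  have := h.symm.pow_E_F m f
  rw [hE, map_zero] at this
  simp only [LinearMap.neg_apply, hH, map_neg, map_smul] at this
  rw [eq_neg_of_add_eq_zero_left this.symm]
  module

theorem Sl2Ops.H_pow_F_of_weight (h : Sl2Ops E F H) {f : V} {w : ℝ}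
    (hH : H f = w • f) (m : ℕ) : H ((F ^ m) f) = (w - 2 * m) • (F ^ m) f := by
  have := h.symm.H_pow_E m f
  simp only [LinearMap.neg_apply, hH, map_neg, map_smul] at this
  rw [← neg_inj, this]
  module

/-- The weight of a highest weight vector is a natural number. -/
theorem Sl2Ops.exists_nat_weight (h : Sl2Ops E F H) {f : V} {w : ℝ} (hE : E f = 0)
    (hH : H f = w • f) (hf : f ≠ 0) (hF : ∃ N, (F ^ N) f = 0) : ∃ k : ℕ, w = k := by
  classical
  -- With `k + 1` the least power of `F` killing `f`, `0 = E F^{k+1} f = (k+1)(w-k) F^k f` forces `w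
  -- = k`.
  obtain ⟨k, hk⟩ : ∃ k, Nat.find hF = k + 1 := by
    refine Nat.exists_eq_succ_of_ne_zero fun h0 => hf ?_
    simpa [h0] using Nat.find_spec hF
  have h1 := Nat.find_spec hF
  have h2 : (F ^ k) f ≠ 0 := Nat.find_min hF (by omega)
  rw [hk] at h1
  have h3 := h.E_pow_F_of_highest hE hH k
  rw [h1, map_zero] at h3
  rcases smul_eq_zero.1 h3.symm with h4 | h4
  · refine ⟨k, ?_⟩
    rcases mul_eq_zero.1 h4 with h5 | h5
    · have : (0 : ℝ) < k + 1 := by positivity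
      linarith
    · linarith
  · exact absurd h4 h2

theorem Sl2Ops.pow_E_pow_F_of_highest (h : Sl2Ops E F H) {f : V} {w : ℝ} (hE : E f = 0)
    (hH : H f = w • f) (m : ℕ) :
    (E ^ m) ((F ^ m) f) = (∏ i ∈ Finset.range m, ((i + 1) * (w - i) : ℝ)) • f := by
  induction m with
  | zero => simp
  | succ m ih =>
    rw [pow_succ E, Module.End.mul_apply, h.E_pow_F_of_highest hE hH, map_smul, ih,
      Finset.prod_range_succ]
    module

theorem Sl2Ops.pow_E_pow_F_eq_zero (h : Sl2Ops E F H) {f : V} {w : ℝ} (hE : E f = 0)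
    (hH : H f = w • f) {m n : ℕ} (hmn : n < m) : (E ^ m) ((F ^ n) f) = 0 := by
  obtain ⟨d, rfl⟩ : ∃ d, m = d + 1 + n := ⟨m - n - 1, by omega⟩
  rw [pow_add, Module.End.mul_apply, h.pow_E_pow_F_of_highest hE hH, map_smul, pow_succ,
    Module.End.mul_apply, hE, map_zero, smul_zero]

/-- A power of `E` is injective on weight vectors of sufficiently negative weight. -/
theorem Sl2Ops.eq_zero_of_weight (h : Sl2Ops E F H) (r : ℕ) : ∀ (v : V) (μ : ℝ) (m : ℕ),
    H v = μ • v → (F ^ r) v = 0 → (E ^ m) v = 0 → (m : ℝ) ≤ -μ → v = 0 := by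
  induction r with
  | zero => intro v μ m _ hF _ _; simpa using hF
  | succ r ih =>
    intro v μ m hH hF hE hm
    -- The hypotheses pass from `v` to `F v` with `(μ, m)` replaced by `(μ - 2, m + 1)`, so it
    -- suffices to treat lowest weight vectors.
    have hFv : F v = 0 := by
      refine ih (F v) (μ - 2) (m + 1) ?_ (by rwa [pow_succ, Module.End.mul_apply] at hF) ?_ ?_
      · rw [h.lie_H_F, hH, map_smul]; module
      · rw [h.pow_E_F, pow_succ', Module.End.mul_apply, hE, hH, map_smul, hE]
        simp
      · push_cast; linarith
    clear ih
    induction m with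
    | zero => simpa using hE
    | succ m ihm =>
      push_cast at hm
      refine ihm ?_ (by linarith)
      -- Since `F v = 0`, this reads `0 = (m+1)(μ+m) E^m v`, and `μ + m ≤ -1`; the vanishing power
      -- of `E` can thus be lowered down to `0`.
      have := h.pow_E_F m v
      rw [hFv, map_zero, hE, map_zero, hH, map_smul, zero_add, ← add_smul, smul_smul] at this
      refine (smul_eq_zero.1 this.symm).resolve_left ?_
      have : (0 : ℝ) ≤ m := by positivity
      refine mul_ne_zero (by positivity) (by linarith)

theorem Sl2Ops.pow_E_sub (h : Sl2Ops E F H) (m : ℕ) (μ : ℝ) (v : V) :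
    (E ^ m) ((H - algebraMap ℝ (End ℝ V) μ) v) =
      (H - algebraMap ℝ (End ℝ V) (μ + 2 * m)) ((E ^ m) v) := by
  simp only [LinearMap.sub_apply, Module.algebraMap_end_apply, map_sub, map_smul, h.H_pow_E]
  module

theorem Sl2Ops.pow_E_aeval (h : Sl2Ops E F H) (m : ℕ) (P : Polynomial ℝ) (v : V) :
    (E ^ m) (Polynomial.aeval H P v) =
      Polynomial.aeval H (P.comp (Polynomial.X - Polynomial.C (2 * m : ℝ))) ((E ^ m) v) := by
  induction P using Polynomial.induction_on' generalizing v with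
  | add p q hp hq => simp [hp, hq]
  | monomial n a =>
    induction n generalizing v with
    | zero => simp [Module.algebraMap_end_apply]
    | succ n ih =>
      rw [← Polynomial.monomial_mul_X, map_mul, Module.End.mul_apply, ih, Polynomial.mul_comp,
        Polynomial.X_comp, map_mul (Polynomial.aeval H), Module.End.mul_apply, Polynomial.aeval_X]
      congr 1
      simp only [map_sub, Polynomial.aeval_X, Polynomial.aeval_C,
        LinearMap.sub_apply, Module.algebraMap_end_apply, h.H_pow_E]
      module

/-- Nilpotency is peeled off one factor at a time: `(H - μ) v` satisfies the same hypotheses with a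
smaller exponent. This avoids proving that `H` is diagonalizable. -/
theorem Sl2Ops.eq_zero_of_gen_weight (h : Sl2Ops E F H) (hF : ∀ v, ∃ N, (F ^ N) v = 0)
    {μ : ℝ} {m : ℕ} (hm : (m : ℝ) ≤ -μ) (k : ℕ) (v : V)
    (hH : ((H - algebraMap ℝ (End ℝ V) μ) ^ k) v = 0) (hE : (E ^ m) v = 0) : v = 0 := by
  induction k generalizing v with
  | zero => simpa using hH
  | succ k ih =>
    have h0 := ih ((H - algebraMap ℝ (End ℝ V) μ) v)
      (by rwa [pow_succ, Module.End.mul_apply] at hH) (by rw [h.pow_E_sub, hE, map_zero])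
    obtain ⟨r, hr⟩ := hF v
    refine h.eq_zero_of_weight r v μ m ?_ hr hE hm
    simpa [sub_eq_zero, Module.algebraMap_end_apply] using h0

/-- If `E^s v` is a highest weight vector, then it has no components of weight less than `s`. -/
theorem Sl2Ops.exists_poly_of_lt (h : Sl2Ops E F H) (hF : ∀ v, ∃ N, (F ^ N) v = 0)
    {s : ℕ} {w : ℝ} (hw : w + 1 ≤ s) {v : V} (hE : (E ^ (s + 1)) v = 0)
    (hv : ∃ P : Polynomial ℝ, P ≠ 0 ∧ Polynomial.aeval H P v = 0) :
    ∃ Q : Polynomial ℝ, Q.eval w ≠ 0 ∧ Polynomial.aeval H Q ((E ^ s) v) = 0 := by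
  obtain ⟨P, hP, hPv⟩ := hv
  -- Removing the root `w - 2s` leaves `P'(H) v` as the part of `v` that `E^s` would carry to weight
  -- `w`. It is killed by `E^{s+1}`, and `s + 1 ≤ -(w - 2s)`, so it vanishes.
  obtain ⟨P', hP', hd⟩ := P.exists_eq_pow_rootMultiplicity_mul_and_not_dvd hP (w - 2 * s)
  refine ⟨P'.comp (Polynomial.X - Polynomial.C (2 * s : ℝ)), ?_, ?_⟩
  · rw [Polynomial.dvd_iff_isRoot, Polynomial.IsRoot] at hd
    simpa [Polynomial.eval_comp] using hd
  · rw [← h.pow_E_aeval]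
    have : Polynomial.aeval H P' v = 0 := by
      refine h.eq_zero_of_gen_weight hF (μ := w - 2 * s) (m := s + 1) ?_
        (P.rootMultiplicity (w - 2 * s)) _ ?_ ?_
      · push_cast; linarith
      · rw [hP', map_mul] at hPv
        simpa using hPv
      · rw [h.pow_E_aeval, hE, map_zero]
    rw [this, map_zero]

/-- The powers `D^k` have the distinct eigenvalues `kc` under `ad H`; if none vanished they would be
infinitely many independent elements of a finite-dimensional space. -/
theorem isNilpotent_of_lie_eq_smul [FiniteDimensional ℝ V] {D : End ℝ V} {c : ℝ} (hc : c ≠ 0)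
    (hD : H * D - D * H = c • D) : IsNilpotent D := by
  by_contra hn
  have hne : ∀ k : ℕ, D ^ k ≠ 0 := fun k hk => hn ⟨k, hk⟩
  let ad : End ℝ (End ℝ V) := LinearMap.mulLeft ℝ H - LinearMap.mulRight ℝ H
  have had : ∀ k : ℕ, ad (D ^ k) = (k * c : ℝ) • D ^ k := by
    intro k
    induction k with
    | zero => simp [ad]
    | succ k ih =>
      simp only [ad, LinearMap.sub_apply, LinearMap.mulLeft_apply, LinearMap.mulRight_apply]
        at ih ⊢
      have : H * D ^ (k + 1) - D ^ (k + 1) * H =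
          (H * D ^ k - D ^ k * H) * D + D ^ k * (H * D - D * H) := by
        rw [pow_succ]; noncomm_ring
      rw [this, ih, hD, pow_succ, smul_mul_assoc, mul_smul_comm]
      push_cast
      module
  have hli := Module.End.eigenvectors_linearIndependent' ad (fun k : ℕ => (k * c : ℝ))
    (fun a b hab => by simpa [hc] using hab) (fun k => D ^ k)
    (fun k => Module.End.hasEigenvector_iff.2
      ⟨Module.End.mem_eigenspace_iff.2 (had k), hne k⟩)
  have := hli.finite
  exact not_finite ℕ

end Sl2

end BoxProduct

namespace BoxProduct

theorem exists_aeval_eq_zero_of_mem {V : Type*} [AddCommGroup V] [Module ℝ V]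
    {D : Module.End ℝ V} {U : Submodule ℝ V} [FiniteDimensional ℝ U] (hD : ∀ x ∈ U, D x ∈ U)
    {v : V} (hv : v ∈ U) : ∃ P : Polynomial ℝ, P ≠ 0 ∧ Polynomial.aeval D P v = 0 := by
  have hcomp : ∀ (P : Polynomial ℝ) (u : U),
      Polynomial.aeval D P (u : V) = (Polynomial.aeval (D.restrict hD) P u : U) := by
    intro P u
    induction P using Polynomial.induction_on' generalizing u with
    | add p q hp hq => simp [hp, hq]
    | monomial n a =>
      induction n generalizing u with
      | zero => simp [Module.algebraMap_end_apply]
      | succ n ih =>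
        rw [← Polynomial.monomial_mul_X, map_mul, map_mul, Module.End.mul_apply,
          Module.End.mul_apply, Polynomial.aeval_X, Polynomial.aeval_X, ← ih]
        rfl
  refine ⟨minpoly ℝ (D.restrict hD), minpoly.ne_zero_of_finite _ _, ?_⟩
  rw [hcomp _ ⟨v, hv⟩, minpoly.aeval]
  simp

/-! ### Linear vector fields on polynomials, and weights. -/

section PolyD

open MvPolynomial

variable {σ : Type*} [Fintype σ]

theorem polyD_apply (A : Matrix σ σ ℝ) (f : MvPolynomial σ ℝ) :
    polyD A f = ∑ i, (∑ j, C (A i j) * X j) * pderiv i f := by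
  have : ∀ s : Finset σ, (∑ i ∈ s, (∑ j, C (A i j) * X j) • pderiv i :
      Derivation ℝ (MvPolynomial σ ℝ) (MvPolynomial σ ℝ)) f =
      ∑ i ∈ s, (∑ j, C (A i j) * X j) * pderiv i f := by
    classical
    intro s
    induction s using Finset.induction_on with
    | empty => simp
    | insert i s hi ih => simp [Finset.sum_insert hi, ih]
  exact this Finset.univ

theorem polyD_X (A : Matrix σ σ ℝ) (i : σ) : polyD A (X i) = ∑ j, C (A i j) * X j := by
  classical
  rw [polyD_apply, Finset.sum_eq_single i]
  · simp
  · intro b _ hb; simp [pderiv_X, hb.symm]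
  · simp

theorem polyD_add (A B : Matrix σ σ ℝ) (f : MvPolynomial σ ℝ) :
    polyD (A + B) f = polyD A f + polyD B f := by
  simp [polyD_apply, add_mul, Finset.sum_add_distrib]

theorem polyD_smul (c : ℝ) (A : Matrix σ σ ℝ) (f : MvPolynomial σ ℝ) :
    polyD (c • A) f = c • polyD A f := by
  simp [polyD_apply, MvPolynomial.smul_eq_C_mul, Finset.mul_sum, mul_assoc, Finset.sum_mul]

@[simp] theorem polyD_zero (f : MvPolynomial σ ℝ) : polyD (0 : Matrix σ σ ℝ) f = 0 := by
  simp [polyD_apply]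

/-- Passing from matrices to vector fields reverses brackets, which is why `D_Y` plays the raising
operator and `D_X` the lowering one. -/
theorem polyD_lie (A B : Matrix σ σ ℝ) (f : MvPolynomial σ ℝ) :
    polyD A (polyD B f) - polyD B (polyD A f) = polyD (B * A - A * B) f := by
  have : ⁅polyD A, polyD B⁆ = polyD (B * A - A * B) := by
    refine derivation_ext fun i => ?_
    have key : ∀ A B : Matrix σ σ ℝ, polyD A (polyD B (X i)) =
        ∑ k, C ((B * A) i k) * X k := by
      intro A B
      simp only [polyD_X, map_sum, Derivation.leibniz, smul_eq_mul, Matrix.mul_apply,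
        Finset.sum_mul, Finset.mul_sum, map_mul, derivation_C, mul_zero, add_zero, mul_assoc]
      exact Finset.sum_comm
    rw [Derivation.commutator_apply, key, key, polyD_X, ← Finset.sum_sub_distrib]
    simp [sub_mul]
  rw [← this, Derivation.commutator_apply]

theorem IsTriad.sl2Ops {X Y Z : Matrix σ σ ℝ} (h : IsTriad X Y Z) :
    Sl2Ops (polyD Y : Module.End ℝ (MvPolynomial σ ℝ)) (polyD X : Module.End ℝ _)
      (polyD Z : Module.End ℝ _) where
  lie_E_F v := by
    have := polyD_lie Y X v
    rw [h.lie_X_Y] at this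
    simpa using sub_eq_iff_eq_add'.1 this
  lie_H_E v := by
    have := polyD_lie Z Y v
    rw [← neg_sub (Z * Y), h.lie_Z_Y, ← neg_smul, neg_neg, polyD_smul] at this
    simpa using sub_eq_iff_eq_add'.1 this
  lie_H_F v := by
    have := polyD_lie Z X v
    rw [← neg_sub (Z * X), h.lie_Z_X, ← neg_smul, polyD_smul] at this
    rw [sub_eq_add_neg, ← neg_smul]
    simpa using sub_eq_iff_eq_add'.1 this

theorem IsTriad.symm {X Y Z : Matrix σ σ ℝ} (h : IsTriad X Y Z) : IsTriad Y X (-Z) where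
  lie_X_Y := by rw [← h.lie_X_Y]; abel
  lie_Z_X := by
    have := congrArg (- ·) h.lie_Z_Y
    simp only [neg_smul, neg_neg] at this
    rw [← this, neg_mul, mul_neg]; abel
  lie_Z_Y := by
    have := congrArg (- ·) h.lie_Z_X
    rw [neg_smul, ← this, neg_mul, mul_neg]; abel

theorem IsHomogeneous.polyD {f : MvPolynomial σ ℝ} {d : ℕ} (hf : f.IsHomogeneous d)
    (A : Matrix σ σ ℝ) : (polyD A f).IsHomogeneous d := by
  rcases d with _ | d
  · have : f = C (coeff 0 f) :=
      totalDegree_eq_zero_iff_eq_C.1 ((totalDegree_zero_iff_isHomogeneous σ).2 hf)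
    rw [this, derivation_C]
    exact isHomogeneous_zero _ _ _
  · rw [polyD_apply]
    refine IsHomogeneous.sum _ _ _ fun i _ => ?_
    rw [add_comm]
    refine IsHomogeneous.mul ?_ hf.pderiv
    refine IsHomogeneous.sum _ _ _ fun j _ => ?_
    simpa using (isHomogeneous_C σ (A i j)).mul (isHomogeneous_X ℝ j)

theorem IsHomogeneous.polyD_iterate {f : MvPolynomial σ ℝ} {d : ℕ} (hf : f.IsHomogeneous d)
    (A : Matrix σ σ ℝ) (k : ℕ) : ((BoxProduct.polyD A)^[k] f).IsHomogeneous d := by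
  induction k with
  | zero => simpa
  | succ k ih => rw [Function.iterate_succ_apply']; exact IsHomogeneous.polyD ih A

theorem polyD_mem_restrictTotalDegree (A : Matrix σ σ ℝ) (N : ℕ) (f : MvPolynomial σ ℝ)
    (hf : f ∈ restrictTotalDegree σ ℝ N) : polyD A f ∈ restrictTotalDegree σ ℝ N := by
  rw [mem_restrictTotalDegree] at hf
  rw [← sum_homogeneousComponent f, map_sum]
  refine Submodule.sum_mem _ fun i hi => ?_
  rw [mem_restrictTotalDegree]
  refine (IsHomogeneous.polyD (homogeneousComponent_isHomogeneous i f) A).totalDegree_le.trans ?_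
  have := Finset.mem_range.1 hi
  omega

theorem polyD_homogeneousComponent (A : Matrix σ σ ℝ) (d : ℕ) (f : MvPolynomial σ ℝ) :
    homogeneousComponent d (polyD A f) = polyD A (homogeneousComponent d f) := by
  conv_lhs => rw [← sum_homogeneousComponent f, map_sum, map_sum]
  have : ∀ i, homogeneousComponent d (polyD A (homogeneousComponent i f)) =
      if d = i then polyD A (homogeneousComponent i f) else 0 := fun i =>
    homogeneousComponent_of_mem
      (IsHomogeneous.polyD (homogeneousComponent_isHomogeneous i f) A)
  simp only [this]
  rw [Finset.sum_ite_eq (Finset.range (f.totalDegree + 1)) d]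
  split_ifs with h
  · rfl
  · rw [homogeneousComponent_eq_zero _ _ (by simpa using h), map_zero]

theorem exists_aeval_polyD_eq_zero (A : Matrix σ σ ℝ) (f : MvPolynomial σ ℝ) :
    ∃ P : Polynomial ℝ, P ≠ 0 ∧
      Polynomial.aeval (polyD A : Module.End ℝ (MvPolynomial σ ℝ)) P f = 0 := by
  exact exists_aeval_eq_zero_of_mem (D := (polyD A : Module.End ℝ (MvPolynomial σ ℝ)))
    (U := restrictTotalDegree σ ℝ f.totalDegree)
    (fun x hx => polyD_mem_restrictTotalDegree A _ x hx) (by simp [mem_restrictTotalDegree])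

/-- Polynomials of bounded degree form a finite-dimensional stable subspace, on which `[H, F] = -2F`
makes `F` nilpotent. -/
theorem IsTriad.exists_pow_polyD_eq_zero {X Y Z : Matrix σ σ ℝ} (h : IsTriad X Y Z)
    (f : MvPolynomial σ ℝ) :
    ∃ N, ((polyD X : Module.End ℝ (MvPolynomial σ ℝ)) ^ N) f = 0 := by
  let U := restrictTotalDegree σ ℝ f.totalDegree
  have hD : ∀ A : Matrix σ σ ℝ, ∀ x ∈ U, (polyD A : Module.End ℝ (MvPolynomial σ ℝ)) x ∈ U :=
    fun A x hx => polyD_mem_restrictTotalDegree A _ x hx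
  obtain ⟨N, hN⟩ := isNilpotent_of_lie_eq_smul (V := U)
    (H := (polyD Z : Module.End ℝ (MvPolynomial σ ℝ)).restrict (hD Z))
    (D := (polyD X : Module.End ℝ (MvPolynomial σ ℝ)).restrict (hD X)) (c := -2) (by norm_num)
    (by
      ext u : 2
      have := h.sl2Ops.lie_H_F u
      simp only [LinearMap.sub_apply, Module.End.mul_apply, LinearMap.restrict_apply,
        LinearMap.smul_apply, Submodule.coe_sub, Submodule.coe_smul]
      rw [this, neg_smul]
      abel)
  refine ⟨N, ?_⟩
  have := congrArg (fun T : Module.End ℝ U =>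
    (T ⟨f, by simp [U, mem_restrictTotalDegree]⟩ : MvPolynomial σ ℝ)) hN
  rw [Module.End.pow_restrict] at this
  simpa using this

/-! ### Weights -/

theorem IsWeightInvariant.polyD_weight {X Y Z : Matrix σ σ ℝ} (h : IsTriad X Y Z)
    {f : MvPolynomial σ ℝ} (hf : IsWeightInvariant Y Z f) :
    polyD Z f = (weight Z f : ℝ) • f := by
  obtain ⟨w, hw⟩ := hf.eigenvector
  obtain ⟨k, rfl⟩ := h.sl2Ops.exists_nat_weight (by simpa using hf.invariant)
    (by simpa using hw) hf.ne_zero (h.exists_pow_polyD_eq_zero f)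
  exact Nat.sInf_mem (s := {w : ℕ | polyD Z f = (w : ℝ) • f}) ⟨k, hw⟩

theorem weight_eq {Z : Matrix σ σ ℝ} {f : MvPolynomial σ ℝ} (hf : f ≠ 0) {w : ℕ}
    (hw : polyD Z f = (w : ℝ) • f) : weight Z f = w := by
  have h1 : polyD Z f = (weight Z f : ℝ) • f :=
    Nat.sInf_mem (s := {w : ℕ | polyD Z f = (w : ℝ) • f}) ⟨w, hw⟩
  rw [hw] at h1
  exact_mod_cast (smul_left_injective ℝ hf h1).symm

theorem IsWeightInvariant.mul {Y Z : Matrix σ σ ℝ} {f g : MvPolynomial σ ℝ}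
    (hf : IsWeightInvariant Y Z f) (hg : IsWeightInvariant Y Z g) :
    IsWeightInvariant Y Z (f * g) where
  ne_zero := mul_ne_zero hf.ne_zero hg.ne_zero
  invariant := by simp [Derivation.leibniz, hf.invariant, hg.invariant]
  eigenvector := by
    obtain ⟨a, ha⟩ := hf.eigenvector
    obtain ⟨b, hb⟩ := hg.eigenvector
    refine ⟨a + b, ?_⟩
    rw [Derivation.leibniz, ha, hb, smul_eq_mul, smul_eq_mul, mul_smul_comm, mul_smul_comm,
      mul_comm g f, ← add_smul, add_comm]

theorem IsWeightInvariant.one {Y Z : Matrix σ σ ℝ} :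
    IsWeightInvariant Y Z (1 : MvPolynomial σ ℝ) where
  ne_zero := one_ne_zero
  invariant := by simp
  eigenvector := ⟨0, by simp⟩

theorem weight_mul {X Y Z : Matrix σ σ ℝ} (h : IsTriad X Y Z) {f g : MvPolynomial σ ℝ}
    (hf : IsWeightInvariant Y Z f) (hg : IsWeightInvariant Y Z g) :
    weight Z (f * g) = weight Z f + weight Z g := by
  refine weight_eq (hf.mul hg).ne_zero ?_
  rw [Derivation.leibniz, hf.polyD_weight h, hg.polyD_weight h, smul_eq_mul, smul_eq_mul,
    mul_smul_comm, mul_smul_comm, mul_comm g f, ← add_smul, add_comm, Nat.cast_add]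

theorem weight_one (Z : Matrix σ σ ℝ) : weight Z (1 : MvPolynomial σ ℝ) = 0 :=
  weight_eq one_ne_zero (by simp)

end PolyD

/-! ### Monomials in weight invariants. -/

section Mono

variable {σ : Type*} {p : ℕ}

@[simp] theorem mono_zero (α : Fin p → MvPolynomial σ ℝ) : mono α 0 = 1 := by simp [mono]

theorem mono_add (α : Fin p → MvPolynomial σ ℝ) (k l : Fin p →₀ ℕ) :
    mono α (k + l) = mono α k * mono α l := by
  simp [mono, pow_add, Finset.prod_mul_distrib]

theorem mono_single (α : Fin p → MvPolynomial σ ℝ) (i : Fin p) :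
    mono α (Finsupp.single i 1) = α i := by
  classical
  rw [mono, Finset.prod_eq_single i]
  · simp
  · intro b _ hb; simp [hb.symm]
  · simp

theorem mono_isHomogeneous {α : Fin p → MvPolynomial σ ℝ} {δ : Fin p → ℕ}
    (hδ : ∀ i, (α i).IsHomogeneous (δ i)) (k : Fin p →₀ ℕ) :
    (mono α k).IsHomogeneous (∑ i, δ i * k i) :=
  MvPolynomial.IsHomogeneous.prod _ _ _ fun i _ => (hδ i).pow (k i)

variable [Fintype σ]

theorem isWeightInvariant_mono {X Y Z : Matrix σ σ ℝ} (h : IsTriad X Y Z)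
    {α : Fin p → MvPolynomial σ ℝ} (hα : ∀ i, IsWeightInvariant Y Z (α i)) (k : Fin p →₀ ℕ) :
    IsWeightInvariant Y Z (mono α k) ∧ weight Z (mono α k) = ∑ i, weight Z (α i) * k i := by
  induction k using Finsupp.induction_linear with
  | zero => simp [IsWeightInvariant.one, weight_one]
  | add k l hk hl =>
    rw [mono_add]
    refine ⟨hk.1.mul hl.1, ?_⟩
    rw [weight_mul h hk.1 hl.1, hk.2, hl.2, ← Finset.sum_add_distrib]
    simp [mul_add]
  | single i a =>
    induction a with
    | zero => simp [IsWeightInvariant.one, weight_one]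
    | succ a ih =>
      rw [Finsupp.single_add, mono_add, mono_single]
      refine ⟨ih.1.mul (hα i), ?_⟩
      rw [weight_mul h ih.1 (hα i), ih.2]
      classical
      simp [Finsupp.single_apply, mul_add, Finset.sum_add_distrib]

end Mono

end BoxProduct

namespace BoxProduct

/-! ### Reduction of formal invariants to homogeneous polynomial ones. -/

section Formal

variable {σ : Type*} [Fintype σ]

theorem formalD_apply (A : Matrix σ σ ℝ) (f : MvPowerSeries σ ℝ) :
    formalD A f = ∑ i, (∑ j, MvPowerSeries.C (A i j) * MvPowerSeries.X j) *
      MvPowerSeries.pderiv ℝ i f := by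
  have : ∀ s : Finset σ, (∑ i ∈ s, (∑ j, MvPowerSeries.C (A i j) * MvPowerSeries.X j) •
      MvPowerSeries.pderiv ℝ i : Derivation ℝ (MvPowerSeries σ ℝ) (MvPowerSeries σ ℝ)) f =
      ∑ i ∈ s, (∑ j, MvPowerSeries.C (A i j) * MvPowerSeries.X j) *
        MvPowerSeries.pderiv ℝ i f := by
    classical
    intro s
    induction s using Finset.induction_on with
    | empty => simp
    | insert i s hi ih => simp [Finset.sum_insert hi, ih]
  exact this Finset.univ

theorem formalD_coe (A : Matrix σ σ ℝ) (f : MvPolynomial σ ℝ) :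
    formalD A (f : MvPowerSeries σ ℝ) = (polyD A f : MvPolynomial σ ℝ) := by
  have hsum : ∀ (g : σ → MvPolynomial σ ℝ), ((∑ i, g i : MvPolynomial σ ℝ) : MvPowerSeries σ ℝ) =
      ∑ i, (g i : MvPowerSeries σ ℝ) := fun g =>
    map_sum (MvPolynomial.coeToMvPowerSeries.ringHom (R := ℝ) (σ := σ)) g Finset.univ
  rw [formalD_apply, polyD_apply, hsum]
  refine Finset.sum_congr rfl fun i _ => ?_
  rw [MvPolynomial.coe_mul, hsum, MvPowerSeries.pderiv_coe]
  simp

/-- A linear vector field preserves degree, so the degree `d` part of the image depends only on the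
degree `d` part of the series. -/
theorem coeff_formalD_eq_zero (A : Matrix σ σ ℝ) {f : MvPowerSeries σ ℝ} {d : ℕ}
    (hf : ∀ e : σ →₀ ℕ, e.degree = d → MvPowerSeries.coeff e f = 0) (e : σ →₀ ℕ)
    (he : e.degree = d) : MvPowerSeries.coeff e (formalD A f) = 0 := by
  classical
  rw [formalD_apply, map_sum]
  refine Finset.sum_eq_zero fun i _ => ?_
  rw [Finset.sum_mul, map_sum]
  refine Finset.sum_eq_zero fun j _ => ?_
  rw [mul_assoc, MvPowerSeries.coeff_C_mul, MvPowerSeries.coeff_mul]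
  rw [Finset.sum_eq_zero, mul_zero]
  rintro ⟨a, b⟩ hab
  rw [MvPowerSeries.coeff_X]
  split_ifs with h
  · rw [MvPowerSeries.coeff_pderiv, hf, zero_mul, mul_zero]
    rw [← he, ← Finset.HasAntidiagonal.mem_antidiagonal.1 hab, map_add, map_add]
    simp only at h
    rw [h]
    simp [add_comm]
  · simp

/-- The homogeneous component of degree `d` of a formal power series, as a polynomial. -/
noncomputable def formalComponent (d : ℕ) (f : MvPowerSeries σ ℝ) : MvPolynomial σ ℝ := by
  classical
  exact ∑ e ∈ Finset.finsuppAntidiag Finset.univ d,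
    MvPolynomial.monomial e (MvPowerSeries.coeff e f)

theorem mem_finsuppAntidiag_univ [DecidableEq σ] {e : σ →₀ ℕ} {d : ℕ} :
    e ∈ Finset.finsuppAntidiag Finset.univ d ↔ e.degree = d := by
  simp [Finset.mem_finsuppAntidiag, Finsupp.degree_eq_sum]

theorem formalComponent_isHomogeneous (d : ℕ) (f : MvPowerSeries σ ℝ) :
    (formalComponent d f).IsHomogeneous d := by
  classical
  refine MvPolynomial.IsHomogeneous.sum _ _ _ fun e he => ?_
  exact MvPolynomial.isHomogeneous_monomial _ (mem_finsuppAntidiag_univ.1 he)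

theorem coeff_formalComponent {d : ℕ} (f : MvPowerSeries σ ℝ) {e : σ →₀ ℕ} (he : e.degree = d) :
    MvPolynomial.coeff e (formalComponent d f) = MvPowerSeries.coeff e f := by
  classical
  rw [formalComponent, MvPolynomial.coeff_sum]
  simp only [MvPolynomial.coeff_monomial]
  rw [Finset.sum_ite_eq', if_pos (mem_finsuppAntidiag_univ.2 he)]

theorem polyD_formalComponent {A : Matrix σ σ ℝ} {f : MvPowerSeries σ ℝ}
    (hf : f ∈ formalInvariants A) (d : ℕ) : polyD A (formalComponent d f) = 0 := by
  ext e
  rw [MvPolynomial.coeff_zero]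
  by_cases he : e.degree = d
  · have h1 := coeff_formalD_eq_zero A (f := f - (formalComponent d f : MvPolynomial σ ℝ))
      (d := d) (fun e he => by
        rw [map_sub, MvPolynomial.coeff_coe, coeff_formalComponent f he, sub_self]) e he
    have h2 : formalD A f = 0 := hf
    rw [map_sub, h2, formalD_coe, zero_sub, map_neg, MvPolynomial.coeff_coe, neg_eq_zero] at h1
    exact h1
  · exact MvPolynomial.IsHomogeneous.coeff_eq_zero
      (IsHomogeneous.polyD (formalComponent_isHomogeneous d f) A) he

theorem mem_span_of_isFormalCombination {ι : Type*} {g : ι → MvPolynomial σ ℝ} {δ : ι → ℕ}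
    (hg : ∀ i, (g i).IsHomogeneous (δ i)) {c : ι → ℝ} {f : MvPolynomial σ ℝ} {d : ℕ}
    (hf : f.IsHomogeneous d) (h : IsFormalCombination g c f) :
    f ∈ Submodule.span ℝ (Set.range g) := by
  classical
  -- There are finitely many exponents of degree `d`, and each meets finitely many terms; so the
  -- infinite combination becomes a finite one in degree `d`.
  have hfin : (⋃ e ∈ (Finset.finsuppAntidiag Finset.univ d : Finset (σ →₀ ℕ)),
      {i | c i * MvPolynomial.coeff e (g i) ≠ 0}).Finite :=
    Set.Finite.biUnion (Finset.finite_toSet _) fun e _ => (h e).1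
  have : f = ∑ i ∈ hfin.toFinset with δ i = d, c i • g i := by
    ext e
    rw [MvPolynomial.coeff_sum]
    simp only [MvPolynomial.coeff_smul, smul_eq_mul]
    by_cases he : e.degree = d
    · rw [← MvPolynomial.coeff_coe, ← (h e).2]
      refine finsum_eq_sum_of_support_subset _ fun i hi => ?_
      have hi' : c i * MvPolynomial.coeff e (g i) ≠ 0 := hi
      simp only [Finset.coe_filter, Set.Finite.mem_toFinset, Set.mem_ofPred_eq, Set.mem_iUnion]
      refine ⟨⟨e, mem_finsuppAntidiag_univ.2 he, hi'⟩, ?_⟩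
      by_contra hne
      exact hi' (by rw [MvPolynomial.IsHomogeneous.coeff_eq_zero (hg i)
        (fun h' => hne (by rw [← h', he])), mul_zero])
    · rw [MvPolynomial.IsHomogeneous.coeff_eq_zero hf he]
      refine (Finset.sum_eq_zero fun i hi => ?_).symm
      rw [Finset.mem_filter] at hi
      rw [MvPolynomial.IsHomogeneous.coeff_eq_zero (hg i) (by rwa [hi.2]), mul_zero]
  rw [this]
  exact Submodule.sum_mem _ fun i _ =>
    Submodule.smul_mem _ _ (Submodule.subset_span (Set.mem_range_self i))

theorem IsPreferred.mem_span {Y Z : Matrix σ σ ℝ} {p : ℕ} {α : Fin p → MvPolynomial σ ℝ}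
    (hα : IsHilbertBasis Y Z α) {A : Set (Fin p →₀ ℕ)} (hA : IsPreferred Y α A)
    {f : MvPolynomial σ ℝ} (hf : polyD Y f = 0) :
    f ∈ Submodule.span ℝ (Set.range fun k : A => mono α k) := by
  choose δ hδ using hα.homogeneous
  rw [← MvPolynomial.sum_homogeneousComponent f]
  refine Submodule.sum_mem _ fun d _ => ?_
  obtain ⟨c, hc⟩ := hA.spans (MvPolynomial.homogeneousComponent d f : MvPolynomial σ ℝ) (by
    rw [formalInvariants, Set.mem_ofPred_eq, formalD_coe, ← polyD_homogeneousComponent, hf]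
    simp)
  exact mem_span_of_isFormalCombination (fun k : A => mono_isHomogeneous hδ k)
    (MvPolynomial.homogeneousComponent_isHomogeneous d f) hc

end Formal

/-! ### Polynomials in two sets of variables as a tensor product. -/

section Tensor

open TensorProduct MvPolynomial

variable {σ τ : Type*}

theorem tensorEquivSum_tmul (a : MvPolynomial σ ℝ) (b : MvPolynomial τ ℝ) :
    tensorEquivSum ℝ σ τ ℝ (a ⊗ₜ b) = rename Sum.inl a * rename Sum.inr b := by
  have ha : ∀ a : MvPolynomial σ ℝ, tensorEquivSum ℝ σ τ ℝ (a ⊗ₜ 1) = rename Sum.inl a := by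
    intro a
    have : ((tensorEquivSum ℝ σ τ ℝ).toAlgHom.comp
      Algebra.TensorProduct.includeLeft : MvPolynomial σ ℝ →ₐ[ℝ] _) = rename Sum.inl := by
      ext i; simp
    exact DFunLike.congr_fun this a
  have hb : ∀ b : MvPolynomial τ ℝ, tensorEquivSum ℝ σ τ ℝ (1 ⊗ₜ b) = rename Sum.inr b := by
    intro b
    have : ((tensorEquivSum ℝ σ τ ℝ).toAlgHom.comp
      Algebra.TensorProduct.includeRight : MvPolynomial τ ℝ →ₐ[ℝ] _) = rename Sum.inr := by
      ext i; simp
    exact DFunLike.congr_fun this b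
  rw [← ha, ← hb, ← map_mul, Algebra.TensorProduct.tmul_mul_tmul, one_mul, mul_one]

theorem linearIndependent_rename_mul {ι κ : Type*} {f : ι → MvPolynomial σ ℝ}
    {g : κ → MvPolynomial τ ℝ} (hf : LinearIndependent ℝ f) (hg : LinearIndependent ℝ g) :
    LinearIndependent ℝ
      (fun i : ι × κ => rename (Sum.inl : σ → σ ⊕ τ) (f i.1) * rename Sum.inr (g i.2)) := by
  have := (hf.tmul_of_flat_left hg).map' (tensorEquivSum ℝ σ τ ℝ).toLinearEquiv.toLinearMap
    (LinearEquiv.ker _)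
  convert! this using 1
  ext1 i
  simp [tensorEquivSum_tmul]

/-- Over a field every module is flat, so `ker (a ⊗ 1) ∩ ker (1 ⊗ b) = ker a ⊗ ker b`. -/
theorem mem_range_tensor_ker {V W : Type*} [AddCommGroup V] [Module ℝ V] [AddCommGroup W]
    [Module ℝ W] (a : Module.End ℝ V) (b : Module.End ℝ W) {z : V ⊗[ℝ] W}
    (ha : LinearMap.rTensor W a z = 0) (hb : LinearMap.lTensor V b z = 0) :
    ∃ z' : LinearMap.ker a ⊗[ℝ] LinearMap.ker b,
      z = TensorProduct.map (LinearMap.ker a).subtype (LinearMap.ker b).subtype z' := by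
  obtain ⟨z₁, rfl⟩ := (Module.Flat.lTensor_exact V (LinearMap.exact_subtype_ker_map b) z).1 hb
  rw [← LinearMap.comp_apply, LinearMap.rTensor_comp_lTensor, ← LinearMap.lTensor_comp_rTensor,
    LinearMap.comp_apply] at ha
  have h0 : LinearMap.rTensor (LinearMap.ker b) a z₁ = 0 :=
    Module.Flat.lTensor_preserves_injective_linearMap _ (LinearMap.ker b).injective_subtype
      (by rw [ha, map_zero])
  obtain ⟨z₂, rfl⟩ :=
    (Module.Flat.rTensor_exact (LinearMap.ker b) (LinearMap.exact_subtype_ker_map a) z₁).1 h0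
  exact ⟨z₂, by rw [← LinearMap.comp_apply, LinearMap.lTensor_comp_rTensor]⟩

variable [Fintype σ] [Fintype τ]

theorem polyD_blockDiag_inl (A : Matrix σ σ ℝ) (B : Matrix τ τ ℝ) (f : MvPolynomial σ ℝ) :
    polyD (blockDiag A B) (rename Sum.inl f) = rename Sum.inl (polyD A f) := by
  induction f using MvPolynomial.induction_on with
  | C a => simp
  | add p q hp hq => simp [hp, hq]
  | mul_X p i hp => simp [Derivation.leibniz, hp, polyD_X, map_sum]

theorem polyD_blockDiag_inr (A : Matrix σ σ ℝ) (B : Matrix τ τ ℝ) (f : MvPolynomial τ ℝ) :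
    polyD (blockDiag A B) (rename Sum.inr f) = rename Sum.inr (polyD B f) := by
  induction f using MvPolynomial.induction_on with
  | C a => simp
  | add p q hp hq => simp [hp, hq]
  | mul_X p i hp => simp [Derivation.leibniz, hp, polyD_X, map_sum]

theorem polyD_blockDiag_mul (A : Matrix σ σ ℝ) (B : Matrix τ τ ℝ) (f : MvPolynomial σ ℝ)
    (g : MvPolynomial τ ℝ) :
    polyD (blockDiag A B) (rename Sum.inl f * rename Sum.inr g) =
      rename Sum.inl (polyD A f) * rename Sum.inr g +
        rename Sum.inl f * rename Sum.inr (polyD B g) := by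
  rw [Derivation.leibniz, polyD_blockDiag_inl, polyD_blockDiag_inr, smul_eq_mul, smul_eq_mul]
  ring

theorem mem_span_of_polyD_eq_zero {ι κ : Type*} {Y₁ : Matrix σ σ ℝ} {Y₂ : Matrix τ τ ℝ}
    {f : ι → MvPolynomial σ ℝ} {g : κ → MvPolynomial τ ℝ}
    (hf : ∀ a, polyD Y₁ a = 0 → a ∈ Submodule.span ℝ (Set.range f))
    (hg : ∀ b, polyD Y₂ b = 0 → b ∈ Submodule.span ℝ (Set.range g))
    {h : MvPolynomial (σ ⊕ τ) ℝ} (h₁ : polyD (blockDiag Y₁ 0) h = 0)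
    (h₂ : polyD (blockDiag 0 Y₂) h = 0) :
    h ∈ Submodule.span ℝ (Set.range fun i : ι × κ =>
      rename (Sum.inl : σ → σ ⊕ τ) (f i.1) * rename Sum.inr (g i.2)) := by
  obtain ⟨z, rfl⟩ := (tensorEquivSum ℝ σ τ ℝ).surjective h
  have k₁ : ∀ z, polyD (blockDiag Y₁ 0) (tensorEquivSum ℝ σ τ ℝ z) =
      tensorEquivSum ℝ σ τ ℝ (LinearMap.rTensor _ (polyD Y₁ : Module.End ℝ _) z) := by
    intro z
    induction z using TensorProduct.induction_on with
    | zero => simp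
    | add x y hx hy => simp [hx, hy]
    | tmul a b =>
      simp only [LinearMap.rTensor_tmul, tensorEquivSum_tmul,
        polyD_blockDiag_mul, polyD_zero, map_zero, mul_zero, add_zero]
      rfl
  have k₂ : ∀ z, polyD (blockDiag 0 Y₂) (tensorEquivSum ℝ σ τ ℝ z) =
      tensorEquivSum ℝ σ τ ℝ (LinearMap.lTensor _ (polyD Y₂ : Module.End ℝ _) z) := by
    intro z
    induction z using TensorProduct.induction_on with
    | zero => simp
    | add x y hx hy => simp [hx, hy]
    | tmul a b =>
      simp only [LinearMap.lTensor_tmul, tensorEquivSum_tmul,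
        polyD_blockDiag_mul, polyD_zero, map_zero, zero_mul, zero_add]
      rfl
  rw [k₁, EmbeddingLike.map_eq_zero_iff] at h₁
  rw [k₂, EmbeddingLike.map_eq_zero_iff] at h₂
  obtain ⟨w, rfl⟩ := mem_range_tensor_ker _ _ h₁ h₂
  clear h₁ h₂
  induction w using TensorProduct.induction_on with
  | zero => simp
  | add x y hx hy =>
    rw [map_add, map_add]
    exact Submodule.add_mem _ hx hy
  | tmul a b =>
    rw [TensorProduct.map_tmul, tensorEquivSum_tmul]
    have ha := hf a a.2
    have hb := hg b b.2
    simp only [Submodule.subtype_apply]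
    generalize (a : MvPolynomial σ ℝ) = a' at ha
    generalize (b : MvPolynomial τ ℝ) = b' at hb
    induction ha using Submodule.span_induction with
    | zero => simp
    | add x y _ _ hx hy => rw [map_add, add_mul]; exact Submodule.add_mem _ hx hy
    | smul c x _ hx => rw [map_smul, smul_mul_assoc]; exact Submodule.smul_mem _ _ hx
    | mem x hx =>
      obtain ⟨i, rfl⟩ := hx
      induction hb using Submodule.span_induction with
      | zero => simp
      | add x y _ _ hx hy => rw [map_add, mul_add]; exact Submodule.add_mem _ hx hy
      | smul c x _ hx => rw [map_smul, mul_smul_comm]; exact Submodule.smul_mem _ _ hx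
      | mem y hy =>
        obtain ⟨j, rfl⟩ := hy
        exact Submodule.subset_span ⟨(i, j), rfl⟩

theorem IsTriad.blockDiag {X₁ Y₁ Z₁ : Matrix σ σ ℝ} {X₂ Y₂ Z₂ : Matrix τ τ ℝ}
    (h₁ : IsTriad X₁ Y₁ Z₁) (h₂ : IsTriad X₂ Y₂ Z₂) :
    IsTriad (blockDiag X₁ X₂) (blockDiag Y₁ Y₂) (blockDiag Z₁ Z₂) where
  lie_X_Y := by
    simp [Matrix.fromBlocks_multiply, sub_eq_add_neg, Matrix.fromBlocks_neg,
      Matrix.fromBlocks_add, ← h₁.lie_X_Y, ← h₂.lie_X_Y]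
  lie_Z_X := by
    simp [Matrix.fromBlocks_multiply, Matrix.fromBlocks_smul, ← h₁.lie_Z_X, ← h₂.lie_Z_X,
      sub_eq_add_neg, Matrix.fromBlocks_neg, Matrix.fromBlocks_add]
  lie_Z_Y := by
    rw [Matrix.fromBlocks_smul, ← h₁.lie_Z_Y, ← h₂.lie_Z_Y]
    simp [Matrix.fromBlocks_multiply,
      sub_eq_add_neg, Matrix.fromBlocks_neg, Matrix.fromBlocks_add]

theorem IsTriad.zero : IsTriad (0 : Matrix σ σ ℝ) 0 0 := ⟨by simp, by simp, by simp⟩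

end Tensor

end BoxProduct

namespace BoxProduct

/-! ### Leading term of a product under a derivation. -/

section Leibniz

variable {A : Type*} [CommRing A] [Algebra ℝ A]

theorem pow_derivation_mul_of_eq_zero (D : Derivation ℝ A A) {P : A} (hP : D P = 0) (b : ℕ)
    (Q : A) : ((D : Module.End ℝ A) ^ b) (P * Q) = P * ((D : Module.End ℝ A) ^ b) Q := by
  induction b generalizing Q with
  | zero => simp
  | succ b ih =>
    have : D (P * Q) = P * D Q := by simp [Derivation.leibniz, hP]
    simp [pow_succ, this, ih]

/-- The top order term of the Leibniz rule for a locally nilpotent derivation. -/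
theorem exists_pow_derivation_mul (D : Derivation ℝ A A) (k : ℕ) : ∀ (a b : ℕ) (P Q : A),
    a + b = k → ((D : Module.End ℝ A) ^ (a + 1)) P = 0 → ((D : Module.End ℝ A) ^ (b + 1)) Q = 0 →
    ∃ n : ℕ, n ≠ 0 ∧ ((D : Module.End ℝ A) ^ k) (P * Q) =
      (n : ℝ) • (((D : Module.End ℝ A) ^ a) P * ((D : Module.End ℝ A) ^ b) Q) := by
  induction k with
  | zero =>
    intro a b P Q hab _ _
    obtain ⟨rfl, rfl⟩ : a = 0 ∧ b = 0 := by omega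
    exact ⟨1, by simp⟩
  | succ k ih =>
    intro a b P Q hab hP hQ
    rcases a with _ | a
    · obtain rfl : b = k + 1 := by omega
      refine ⟨1, one_ne_zero, ?_⟩
      rw [pow_derivation_mul_of_eq_zero D (by simpa using hP)]
      simp
    rcases b with _ | b
    · obtain rfl : a = k := by omega
      refine ⟨1, one_ne_zero, ?_⟩
      rw [mul_comm P, pow_derivation_mul_of_eq_zero D (by simpa using hQ), mul_comm]
      simp
    obtain ⟨n₁, hn₁, h₁⟩ := ih a (b + 1) (D P) Q (by omega)
      (by rwa [pow_succ, Module.End.mul_apply] at hP) hQ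
    obtain ⟨n₂, hn₂, h₂⟩ := ih (a + 1) b P (D Q) (by omega) hP
      (by rwa [pow_succ, Module.End.mul_apply] at hQ)
    -- Pascal's rule: the constant is a binomial coefficient, but only its being nonzero matters.
    refine ⟨n₁ + n₂, by omega, ?_⟩
    have e : (D : Module.End ℝ A) (P * Q) = D P * Q + P * D Q := by
      simp [Derivation.leibniz]; ring
    rw [pow_succ, Module.End.mul_apply, e, map_add, h₁, h₂, pow_succ _ a, pow_succ _ b,
      Module.End.mul_apply, Module.End.mul_apply, Nat.cast_add, add_smul]
    rfl

end Leibniz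

/-! ### Transvectants: invariance, weight and leading term. -/

section Transvectant

open MvPolynomial

variable {σ τ : Type*} [Fintype σ] [Fintype τ]

/-- `polyD A` as an endomorphism. -/
noncomputable abbrev polyEnd (A : Matrix σ σ ℝ) : Module.End ℝ (MvPolynomial σ ℝ) :=
  (polyD A : Module.End ℝ (MvPolynomial σ ℝ))

theorem polyEnd_pow_apply (A : Matrix σ σ ℝ) (k : ℕ) (f : MvPolynomial σ ℝ) :
    (polyEnd A ^ k) f = (polyD A)^[k] f := by
  rw [Module.End.pow_apply]; rfl

/-- `P` is an invariant of `diag(Y₁, Y₂)` whose highest nonvanishing derivative along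
`diag(Y₁, 0)` is the `s`-th one, and that one is a nonzero multiple of `h`. -/
structure HasLeading (Y₁ : Matrix σ σ ℝ) (Y₂ : Matrix τ τ ℝ) (s : ℕ)
    (h P : MvPolynomial (σ ⊕ τ) ℝ) : Prop where
  invariant : polyD (blockDiag Y₁ Y₂) P = 0
  pow_succ : (polyEnd (blockDiag Y₁ 0) ^ (s + 1)) P = 0
  pow : ∃ c : ℝ, c ≠ 0 ∧ (polyEnd (blockDiag Y₁ 0) ^ s) P = c • h

theorem HasLeading.one (Y₁ : Matrix σ σ ℝ) (Y₂ : Matrix τ τ ℝ) :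
    HasLeading Y₁ Y₂ 0 1 1 where
  invariant := by simp
  pow_succ := by simp [polyEnd]
  pow := ⟨1, by simp⟩

theorem HasLeading.mul {Y₁ : Matrix σ σ ℝ} {Y₂ : Matrix τ τ ℝ} {s t : ℕ}
    {g h P Q : MvPolynomial (σ ⊕ τ) ℝ} (hP : HasLeading Y₁ Y₂ s g P)
    (hQ : HasLeading Y₁ Y₂ t h Q) : HasLeading Y₁ Y₂ (s + t) (g * h) (P * Q) := by
  obtain ⟨c, hc, hcP⟩ := hP.pow
  obtain ⟨d, hd, hdQ⟩ := hQ.pow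
  obtain ⟨n, hn, e⟩ := exists_pow_derivation_mul (polyD (blockDiag Y₁ 0)) (s + t) s t P Q rfl
    hP.pow_succ hQ.pow_succ
  refine ⟨by simp [Derivation.leibniz, hP.invariant, hQ.invariant], ?_, n * (c * d),
    mul_ne_zero (Nat.cast_ne_zero.2 hn) (mul_ne_zero hc hd), ?_⟩
  · rw [_root_.pow_succ', Module.End.mul_apply, e, map_smul]
    have h1 := hP.pow_succ
    have h2 := hQ.pow_succ
    rw [_root_.pow_succ', Module.End.mul_apply] at h1 h2
    simp only [Derivation.coeFn_coe] at h1 h2 ⊢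
    rw [Derivation.leibniz, h1, h2]
    simp
  · rw [e, hcP, hdQ, smul_mul_smul_comm, smul_smul]

theorem polyEnd_blockDiag_pow_mul (A : Matrix σ σ ℝ) (k : ℕ) (f : MvPolynomial σ ℝ)
    (g : MvPolynomial τ ℝ) :
    (polyEnd (blockDiag A 0) ^ k) (rename Sum.inl f * rename Sum.inr g) =
      rename Sum.inl ((polyEnd A ^ k) f) * rename Sum.inr g := by
  induction k generalizing f with
  | zero => simp
  | succ k ih =>
    rw [pow_succ, Module.End.mul_apply, pow_succ, Module.End.mul_apply, ← ih]
    congr 1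
    simp only [Derivation.coeFn_coe, polyD_blockDiag_mul]
    simp

/-- The coefficients of the transvectant of invariants of weights `a` and `b`. -/
noncomputable def transvectantCoeff (a b s j : ℕ) : ℝ :=
  (-1 : ℝ) ^ j * ((s.choose j : ℝ) * (((a - j).factorial : ℝ) / ((a - s).factorial : ℝ))
    * (((b - s + j).factorial : ℝ) / ((b - s).factorial : ℝ)))

theorem transvectantCoeff_ne_zero {a b s j : ℕ} (hj : j ≤ s) : transvectantCoeff a b s j ≠ 0 := by
  have := Nat.choose_pos hj
  have h1 := Nat.factorial_pos (a - j)
  have h2 := Nat.factorial_pos (a - s)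
  have h3 := Nat.factorial_pos (b - s + j)
  have h4 := Nat.factorial_pos (b - s)
  unfold transvectantCoeff
  positivity

/-- This is the coefficient of `(F^j f)(F^{s-1-j} g)` after raising the transvectant, by `E F^{i+1}
f = (i+1)(a-i) F^i f` and its analogue for `g`. It reduces to `binom(s, j+1)(j+1) = binom(s,
j)(s-j)`. -/
theorem transvectantCoeff_succ {a b s j : ℕ} (ha : s ≤ a) (hb : s ≤ b) (hj : j < s) :
    transvectantCoeff a b s (j + 1) * ((j + 1) * (a - j)) +
      transvectantCoeff a b s j * (((s - 1 - j : ℕ) + 1) * (b - (s - 1 - j : ℕ))) = 0 := by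
  obtain ⟨d, rfl⟩ : ∃ d, s = j + 1 + d := ⟨s - (j + 1), by omega⟩
  obtain ⟨a', rfl⟩ := Nat.exists_eq_add_of_le ha
  obtain ⟨b', rfl⟩ := Nat.exists_eq_add_of_le hb
  have e1 : j + 1 + d + a' - (j + 1) = d + a' := by omega
  have e2 : j + 1 + d + a' - (j + 1 + d) = a' := by omega
  have e3 : j + 1 + d + b' - (j + 1 + d) = b' := by omega
  have e4 : j + 1 + d + a' - j = d + a' + 1 := by omega
  have e5 : j + 1 + d - 1 - j = d := by omega
  have hch : ((j + 1 + d).choose (j + 1) : ℝ) * (j + 1) = (j + 1 + d).choose j * (d + 1) := by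
    have := Nat.choose_succ_right_eq (j + 1 + d) j
    rw [show j + 1 + d - j = d + 1 by omega] at this
    exact_mod_cast this
  unfold transvectantCoeff
  rw [e1, e2, e3, e4, e5, ← add_assoc, Nat.factorial_succ, Nat.factorial_succ]
  push_cast
  have h2 : (a'.factorial : ℝ) ≠ 0 := Nat.cast_ne_zero.2 (Nat.factorial_ne_zero _)
  have h4 : (b'.factorial : ℝ) ≠ 0 := Nat.cast_ne_zero.2 (Nat.factorial_ne_zero _)
  field_simp
  rw [pow_succ]
  linear_combination (-1 : ℝ) ^ j * (-1) * (d + a').factorial * (b' + j).factorial * ((d : ℝ) + a' + 1) * ((b' : ℝ) + j + 1) * hch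

theorem transvectant_eq (X₁ Z₁ : Matrix σ σ ℝ) (X₂ Z₂ : Matrix τ τ ℝ)
    (f : MvPolynomial σ ℝ) (g : MvPolynomial τ ℝ) (s : ℕ) :
    transvectant X₁ Z₁ X₂ Z₂ f g s = ∑ j ∈ Finset.range (s + 1),
      transvectantCoeff (weight Z₁ f) (weight Z₂ g) s j •
        (rename Sum.inl ((polyEnd X₁ ^ j) f) * rename Sum.inr ((polyEnd X₂ ^ (s - j)) g)) := by
  simp only [transvectant, transvectantCoeff, polyEnd_pow_apply]

variable {X₁ Y₁ Z₁ : Matrix σ σ ℝ} {X₂ Y₂ Z₂ : Matrix τ τ ℝ} {f : MvPolynomial σ ℝ}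
  {g : MvPolynomial τ ℝ} {s : ℕ}

theorem polyD_transvectant (h₁ : IsTriad X₁ Y₁ Z₁) (h₂ : IsTriad X₂ Y₂ Z₂)
    (hf : IsWeightInvariant Y₁ Z₁ f) (hg : IsWeightInvariant Y₂ Z₂ g)
    (hsf : s ≤ weight Z₁ f) (hsg : s ≤ weight Z₂ g) :
    polyD (blockDiag Y₁ Y₂) (transvectant X₁ Z₁ X₂ Z₂ f g s) = 0 := by
  have kf := h₁.sl2Ops.E_pow_F_of_highest (f := f) hf.invariant (hf.polyD_weight h₁)
  have kg := h₂.sl2Ops.E_pow_F_of_highest (f := g) hg.invariant (hg.polyD_weight h₂)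
  simp only [Derivation.coeFn_coe] at kf kg
  rw [transvectant_eq, map_sum]
  simp only [Derivation.map_smul, polyD_blockDiag_mul, smul_add, Finset.sum_add_distrib]
  -- The `j = 0` term of the first sum and the `j = s` term of the second vanish, as `f` and `g` are
  -- invariants; the remaining terms cancel in pairs after the shift of index.
  rw [Finset.sum_range_succ', Finset.sum_range_succ]
  simp only [pow_zero, Module.End.one_apply, hf.invariant, hg.invariant, map_zero, zero_mul,
    mul_zero, smul_zero, add_zero, Nat.sub_self]
  rw [← Finset.sum_add_distrib]
  refine Finset.sum_eq_zero fun j hj => ?_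
  have hj := Finset.mem_range.1 hj
  have e := transvectantCoeff_succ hsf hsg hj
  rw [show s - (j + 1) = s - 1 - j by omega, show s - j = s - 1 - j + 1 by omega, kf, kg,
    map_smul, map_smul, smul_mul_assoc, mul_smul_comm, smul_smul, smul_smul, ← add_smul, e,
    zero_smul]

/-- Raising `s` times in the first block kills every `F^j f` with `j < s`. Only `j = s` survives,
with factor `∏ (i+1)(f̂-i)`, nonzero because `s ≤ f̂`. -/
theorem hasLeading_transvectant (h₁ : IsTriad X₁ Y₁ Z₁) (h₂ : IsTriad X₂ Y₂ Z₂)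
    (hf : IsWeightInvariant Y₁ Z₁ f) (hg : IsWeightInvariant Y₂ Z₂ g)
    (hsf : s ≤ weight Z₁ f) (hsg : s ≤ weight Z₂ g) :
    HasLeading Y₁ Y₂ s (rename Sum.inl f * rename Sum.inr g)
      (transvectant X₁ Z₁ X₂ Z₂ f g s) := by
  have kf : ∀ {m n : ℕ}, n < m → (polyEnd Y₁ ^ m) ((polyEnd X₁ ^ n) f) = 0 := fun hmn =>
    h₁.sl2Ops.pow_E_pow_F_eq_zero hf.invariant (hf.polyD_weight h₁) hmn
  refine ⟨polyD_transvectant h₁ h₂ hf hg hsf hsg, ?_, transvectantCoeff (weight Z₁ f)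
    (weight Z₂ g) s s * ∏ i ∈ Finset.range s, ((i + 1) * (weight Z₁ f - i) : ℝ), ?_, ?_⟩
  · rw [transvectant_eq, map_sum]
    refine Finset.sum_eq_zero fun j hj => ?_
    rw [map_smul, polyEnd_blockDiag_pow_mul, kf (Finset.mem_range.1 hj)]
    simp
  · refine mul_ne_zero (transvectantCoeff_ne_zero le_rfl) (Finset.prod_ne_zero_iff.2 fun i hi => ?_)
    have hi := Finset.mem_range.1 hi
    have : (i : ℝ) < weight Z₁ f := by exact_mod_cast hi.trans_le hsf
    exact mul_ne_zero (by positivity) (by linarith)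
  · rw [transvectant_eq, map_sum, Finset.sum_range_succ, Finset.sum_eq_zero, zero_add, map_smul,
      polyEnd_blockDiag_pow_mul,
      h₁.sl2Ops.pow_E_pow_F_of_highest (f := f) hf.invariant (hf.polyD_weight h₁)]
    · simp [smul_smul]
    · intro j hj
      rw [map_smul, polyEnd_blockDiag_pow_mul, kf (Finset.mem_range.1 hj)]
      simp

theorem isWeightInvariant_transvectant (h₁ : IsTriad X₁ Y₁ Z₁) (h₂ : IsTriad X₂ Y₂ Z₂)
    (hf : IsWeightInvariant Y₁ Z₁ f) (hg : IsWeightInvariant Y₂ Z₂ g)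
    (hsf : s ≤ weight Z₁ f) (hsg : s ≤ weight Z₂ g) :
    IsWeightInvariant (blockDiag Y₁ Y₂) (blockDiag Z₁ Z₂)
      (transvectant X₁ Z₁ X₂ Z₂ f g s) where
  ne_zero h0 := by
    obtain ⟨c, hc, e⟩ := (hasLeading_transvectant h₁ h₂ hf hg hsf hsg).pow
    rw [h0, map_zero] at e
    refine smul_ne_zero hc (mul_ne_zero ?_ ?_) e.symm
    · exact (map_ne_zero_iff _ (rename_injective _ Sum.inl_injective)).2 hf.ne_zero
    · exact (map_ne_zero_iff _ (rename_injective _ Sum.inr_injective)).2 hg.ne_zero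
  invariant := polyD_transvectant h₁ h₂ hf hg hsf hsg
  eigenvector := by
    have kf := h₁.sl2Ops.H_pow_F_of_weight (f := f) (hf.polyD_weight h₁)
    have kg := h₂.sl2Ops.H_pow_F_of_weight (f := g) (hg.polyD_weight h₂)
    simp only [Derivation.coeFn_coe] at kf kg
    refine ⟨weight Z₁ f + weight Z₂ g - 2 * s, ?_⟩
    rw [transvectant_eq, map_sum, Finset.smul_sum]
    refine Finset.sum_congr rfl fun j hj => ?_
    have hj := Nat.lt_succ_iff.1 (Finset.mem_range.1 hj)
    rw [Derivation.map_smul, polyD_blockDiag_mul, kf, kg, map_smul, map_smul, smul_mul_assoc,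
      mul_smul_comm, ← add_smul, smul_comm, Nat.cast_sub hj]
    congr 1
    ring

theorem transvectant_isHomogeneous {d e : ℕ} (hf : f.IsHomogeneous d) (hg : g.IsHomogeneous e) :
    (transvectant X₁ Z₁ X₂ Z₂ f g s).IsHomogeneous (d + e) := by
  refine IsHomogeneous.sum _ _ _ fun j _ => ?_
  rw [MvPolynomial.smul_eq_C_mul, ← zero_add (d + e)]
  exact (isHomogeneous_C _ _).mul
    ((BoxProduct.IsHomogeneous.polyD_iterate hf X₁ j).rename_isHomogeneous.mul
      (BoxProduct.IsHomogeneous.polyD_iterate hg X₂ (s - j)).rename_isHomogeneous)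

end Transvectant

end BoxProduct

namespace BoxProduct

/-! ### Combinatorics of the transvectant cone. -/

section Cone

variable {σ τ : Type*} [Fintype σ] [Fintype τ] {Z₁ : Matrix σ σ ℝ} {Z₂ : Matrix τ τ ℝ} {p q : ℕ}
  {α : Fin p → MvPolynomial σ ℝ} {β : Fin q → MvPolynomial τ ℝ}

theorem IsStandard.mem_of_add_mem {A : Set (Fin p →₀ ℕ)} (hA : IsStandard A)
    {k l : Fin p →₀ ℕ} (h : k + l ∈ A) : k ∈ A := by
  obtain ⟨G, I, -, rfl⟩ := hA
  refine fun hk => h ?_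
  have : MvPolynomial.monomial (k + l) (1 : ℝ) =
      MvPolynomial.monomial l 1 * MvPolynomial.monomial k 1 := by
    rw [MvPolynomial.monomial_mul, add_comm, one_mul]
  rw [this]
  exact I.mul_mem_left _ hk

theorem weakSpanning_primes_cone {v : Vec p q} (hv : v ∈ cone Z₁ Z₂ α β) :
    ∃ m : Multiset (Vec p q), (∀ a ∈ m, a ∈ primes (cone Z₁ Z₂ α β)) ∧ m.sum = v := by
  obtain ⟨n, hn⟩ : ∃ n, v.1.degree + v.2.1.degree + v.2.2 = n := ⟨_, rfl⟩
  induction n using Nat.strong_induction_on generalizing v with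
  | _ n ih =>
    by_cases h0 : v = 0
    · exact ⟨0, by simp, by simp [h0]⟩
    by_cases hp : v ∈ primes (cone Z₁ Z₂ α β)
    · exact ⟨{v}, by simpa using hp, by simp⟩
    · have : ∃ a ∈ cone Z₁ Z₂ α β, ∃ b ∈ cone Z₁ Z₂ α β, v = a + b ∧ a ≠ 0 ∧ b ≠ 0 := by
        by_contra hcon
        push Not at hcon
        exact hp ⟨hv, h0, fun a ha b hb hab => or_iff_not_imp_left.2 (hcon a ha b hb hab)⟩
      obtain ⟨a, ha, b, hb, rfl, ha0, hb0⟩ := this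
      have pos : ∀ a : Vec p q, a ≠ 0 → 0 < a.1.degree + a.2.1.degree + a.2.2 := by
        intro a ha
        by_contra hcon
        refine ha (Prod.ext ?_ (Prod.ext ?_ ?_))
        · exact (Finsupp.degree_eq_zero_iff _).1 (by omega)
        · exact (Finsupp.degree_eq_zero_iff _).1 (by omega)
        · exact (by omega : a.2.2 = 0)
      have pa := pos a ha0
      have pb := pos b hb0
      simp only [Prod.fst_add, Prod.snd_add, map_add] at hn
      obtain ⟨m₁, hm₁, e₁⟩ := ih _ (by omega) ha rfl
      obtain ⟨m₂, hm₂, e₂⟩ := ih _ (by omega) hb rfl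
      refine ⟨m₁ + m₂, fun x hx => ?_, by rw [Multiset.sum_add, e₁, e₂]⟩
      exact (Multiset.mem_add.1 hx).elim (hm₁ x) (hm₂ x)

theorem finite_primes_cone : (primes (cone Z₁ Z₂ α β)).Finite := by
  -- The last two entries are the slacks of the cone inequalities. With them, `φ a ≤ φ b` says that
  -- `b - a` lies in the cone, so the primes map to an antichain, finite by Dickson's lemma.
  let φ : Vec p q → (Fin p → ℕ) × (Fin q → ℕ) × ℕ × ℕ × ℕ := fun v =>
    (v.1, v.2.1, v.2.2, ∑ i, weight Z₁ (α i) * v.1 i - v.2.2,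
      ∑ j, weight Z₂ (β j) * v.2.1 j - v.2.2)
  have hφ : Function.Injective φ := by
    intro v w h
    simp only [φ, Prod.mk.injEq, DFunLike.coe_fn_eq] at h
    exact Prod.ext h.1 (Prod.ext h.2.1 h.2.2.1)
  refine Set.Finite.of_finite_image (f := φ) ?_ hφ.injOn
  refine WellQuasiOrderedLE.finite_of_isAntichain ?_
  rintro _ ⟨a, ha, rfl⟩ _ ⟨b, hb, rfl⟩ hne hle
  obtain ⟨h1, h2, h3, h4, h5⟩ := hle
  simp only [φ] at h1 h2 h3 h4 h5
  have e : b = a + (b.1 - a.1, b.2.1 - a.2.1, b.2.2 - a.2.2) := by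
    refine Prod.ext ?_ (Prod.ext ?_ ?_)
    · exact (add_tsub_cancel_of_le (show a.1 ≤ b.1 from h1)).symm
    · exact (add_tsub_cancel_of_le (show a.2.1 ≤ b.2.1 from h2)).symm
    · exact (add_tsub_cancel_of_le h3).symm
  have s1 : ∑ i, weight Z₁ (α i) * b.1 i =
      ∑ i, weight Z₁ (α i) * a.1 i + ∑ i, weight Z₁ (α i) * (b.1 - a.1) i := by
    rw [← Finset.sum_add_distrib]
    refine Finset.sum_congr rfl fun i _ => ?_
    have : a.1 i ≤ b.1 i := h1 i
    rw [← mul_add, Finsupp.tsub_apply, Nat.add_sub_cancel' this]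
  have s2 : ∑ j, weight Z₂ (β j) * b.2.1 j =
      ∑ j, weight Z₂ (β j) * a.2.1 j + ∑ j, weight Z₂ (β j) * (b.2.1 - a.2.1) j := by
    rw [← Finset.sum_add_distrib]
    refine Finset.sum_congr rfl fun i _ => ?_
    have : a.2.1 i ≤ b.2.1 i := h2 i
    rw [← mul_add, Finsupp.tsub_apply, Nat.add_sub_cancel' this]
  have hac := ha.1
  have hbc := hb.1
  simp only [cone, Set.mem_ofPred_eq] at hac hbc
  rcases hb.2.2 a ha.1 (b.1 - a.1, b.2.1 - a.2.1, b.2.2 - a.2.2)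
    (by constructor <;> simp only <;> omega) e with h | h
  · exact ha.2.1 h
  · rw [h, add_zero] at e
    exact hne (by rw [e])

theorem isWeakSpanningSet_admissiblePart {A₁ : Set (Fin p →₀ ℕ)} {A₂ : Set (Fin q →₀ ℕ)}
    (hs₁ : IsStandard A₁) (hs₂ : IsStandard A₂) :
    IsWeakSpanningSet (admissiblePart A₁ A₂ (primes (cone Z₁ Z₂ α β)))
      (admissiblePart A₁ A₂ (cone Z₁ Z₂ α β)) := by
  refine ⟨fun v hv => ⟨hv.1.1, hv.2⟩, fun v hv => ?_⟩
  -- Decompose in the whole cone; each summand divides an admissible vector, hence is itself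
  -- admissible by standardness.
  obtain ⟨m, hm, rfl⟩ := weakSpanning_primes_cone hv.1
  refine ⟨m, fun a ha => ⟨hm a ha, ?_⟩, rfl⟩
  obtain ⟨m', rfl⟩ := Multiset.exists_cons_of_mem ha
  have h2 := hv.2
  rw [Multiset.sum_cons] at h2
  exact ⟨hs₁.mem_of_add_mem h2.1, hs₂.mem_of_add_mem h2.2⟩

end Cone

end BoxProduct

namespace BoxProduct

/-- `Q(H)` acts diagonally on the independent eigenvectors `G i`, with entries `Q(w i)`. -/
theorem coeff_eq_zero_of_aeval_eq_zero {V ι : Type*} [AddCommGroup V] [Module ℝ V]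
    {H : Module.End ℝ V} {G : ι → V} (hG : LinearIndependent ℝ G) {w : ι → ℝ}
    (hw : ∀ i, H (G i) = w i • G i) {c : ι →₀ ℝ} {Q : Polynomial ℝ}
    (hQ : Polynomial.aeval H Q (c.sum fun i a => a • G i) = 0) {i : ι}
    (hi : Q.eval (w i) ≠ 0) : c i = 0 := by
  have h1 : ∀ j, Polynomial.aeval H Q (G j) = Q.eval (w j) • G j := fun j =>
    Module.End.aeval_apply_of_hasEigenvector
      (Module.End.hasEigenvector_iff.2 ⟨Module.End.mem_eigenspace_iff.2 (hw j), hG.ne_zero j⟩)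
  rw [Finsupp.sum, map_sum] at hQ
  simp only [map_smul, h1, smul_smul] at hQ
  by_contra hc
  have := linearIndependent_iff'.1 hG c.support _ hQ i (Finsupp.mem_support_iff.2 hc)
  exact (mul_ne_zero hc hi) this

/-! ### Leading terms and the Hilbert basis. -/

section Main

open MvPolynomial

variable {σ τ : Type*} {p q : ℕ} {α : Fin p → MvPolynomial σ ℝ}
  {β : Fin q → MvPolynomial τ ℝ}

/-- The product `α^k β^ℓ` as a polynomial in both sets of variables. -/
noncomputable def leadingProduct (α : Fin p → MvPolynomial σ ℝ) (β : Fin q → MvPolynomial τ ℝ)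
    (v : Vec p q) : MvPolynomial (σ ⊕ τ) ℝ :=
  rename Sum.inl (mono α v.1) * rename Sum.inr (mono β v.2.1)

theorem leadingProduct_zero : leadingProduct α β 0 = 1 := by simp [leadingProduct]

theorem leadingProduct_add (v w : Vec p q) :
    leadingProduct α β (v + w) = leadingProduct α β v * leadingProduct α β w := by
  simp only [leadingProduct, Prod.fst_add, Prod.snd_add, mono_add, map_mul]
  ring

theorem linearIndependent_leadingProduct {A₁ : Set (Fin p →₀ ℕ)} {A₂ : Set (Fin q →₀ ℕ)}
    (hA₁ : LinearIndependent ℝ (fun k : A₁ => mono α k))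
    (hA₂ : LinearIndependent ℝ (fun k : A₂ => mono β k)) (s : ℕ) :
    LinearIndependent ℝ (fun i : A₁ × A₂ => leadingProduct α β (i.1, i.2, s)) := by
  have := linearIndependent_rename_mul hA₁ hA₂
  simp only [leadingProduct]
  exact this

variable [Fintype σ] [Fintype τ] {X₁ Y₁ Z₁ : Matrix σ σ ℝ} {X₂ Y₂ Z₂ : Matrix τ τ ℝ}

theorem mem_cone_iff (h₁ : IsTriad X₁ Y₁ Z₁) (h₂ : IsTriad X₂ Y₂ Z₂)
    (hα : IsHilbertBasis Y₁ Z₁ α) (hβ : IsHilbertBasis Y₂ Z₂ β) {v : Vec p q} :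
    v ∈ cone Z₁ Z₂ α β ↔
      v.2.2 ≤ weight Z₁ (mono α v.1) ∧ v.2.2 ≤ weight Z₂ (mono β v.2.1) := by
  rw [(isWeightInvariant_mono h₁ hα.weightInvariant v.1).2,
    (isWeightInvariant_mono h₂ hβ.weightInvariant v.2.1).2]
  rfl

theorem hasLeading_transvectantMap (h₁ : IsTriad X₁ Y₁ Z₁) (h₂ : IsTriad X₂ Y₂ Z₂)
    (hα : IsHilbertBasis Y₁ Z₁ α) (hβ : IsHilbertBasis Y₂ Z₂ β) {v : Vec p q}
    (hv : v ∈ cone Z₁ Z₂ α β) :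
    HasLeading Y₁ Y₂ v.2.2 (leadingProduct α β v) (transvectantMap X₁ Z₁ X₂ Z₂ α β v) := by
  rw [mem_cone_iff h₁ h₂ hα hβ] at hv
  exact hasLeading_transvectant h₁ h₂ (isWeightInvariant_mono h₁ hα.weightInvariant v.1).1
    (isWeightInvariant_mono h₂ hβ.weightInvariant v.2.1).1 hv.1 hv.2

theorem exists_mono_hasLeading {t : ℕ} {π : Fin t → Vec p q}
    {θ : Fin t → MvPolynomial (σ ⊕ τ) ℝ}
    (hθ : ∀ i, HasLeading Y₁ Y₂ (π i).2.2 (leadingProduct α β (π i)) (θ i)) {v : Vec p q}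
    (hv : v ∈ AddSubmonoid.closure (Set.range π)) :
    ∃ m : Fin t →₀ ℕ, HasLeading Y₁ Y₂ v.2.2 (leadingProduct α β v) (mono θ m) := by
  induction hv using AddSubmonoid.closure_induction with
  | mem x hx =>
    obtain ⟨i, rfl⟩ := hx
    exact ⟨Finsupp.single i 1, by rw [mono_single]; exact hθ i⟩
  | zero => exact ⟨0, by rw [mono_zero, leadingProduct_zero]; exact HasLeading.one Y₁ Y₂⟩
  | add x y _ _ hx hy =>
    obtain ⟨m, hm⟩ := hx
    obtain ⟨m', hm'⟩ := hy
    exact ⟨m + m', by rw [mono_add, leadingProduct_add]; exact hm.mul hm'⟩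

theorem polyD_blockDiag_comm (Y₁ : Matrix σ σ ℝ) (Y₂ : Matrix τ τ ℝ)
    (f : MvPolynomial (σ ⊕ τ) ℝ) :
    polyD (blockDiag 0 Y₂) (polyD (blockDiag Y₁ 0) f) =
      polyD (blockDiag Y₁ 0) (polyD (blockDiag 0 Y₂) f) := by
  rw [← sub_eq_zero, polyD_lie]
  simp [Matrix.fromBlocks_multiply]

theorem polyD_blockDiag_add (Y₁ : Matrix σ σ ℝ) (Y₂ : Matrix τ τ ℝ)
    (f : MvPolynomial (σ ⊕ τ) ℝ) :
    polyD (blockDiag Y₁ Y₂) f = polyD (blockDiag Y₁ 0) f + polyD (blockDiag 0 Y₂) f := by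
  rw [← polyD_add, Matrix.fromBlocks_add]
  simp

theorem polyEnd_blockDiag_pow_eq {R : MvPolynomial (σ ⊕ τ) ℝ}
    (hR : polyD (blockDiag Y₁ Y₂) R = 0) (k : ℕ) :
    (polyEnd (blockDiag 0 Y₂) ^ k) R = (-1 : ℝ) ^ k • (polyEnd (blockDiag Y₁ 0) ^ k) R := by
  induction k with
  | zero => simp
  | succ k ih =>
    have hcomm : Commute (polyEnd (blockDiag 0 Y₂)) (polyEnd (blockDiag Y₁ 0)) :=
      LinearMap.ext fun f => polyD_blockDiag_comm Y₁ Y₂ f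
    have h2 : polyEnd (blockDiag 0 Y₂) R = -polyEnd (blockDiag Y₁ 0) R := by
      rw [polyD_blockDiag_add] at hR
      exact eq_neg_of_add_eq_zero_right hR
    rw [pow_succ', Module.End.mul_apply, ih, map_smul, ← Module.End.mul_apply,
      (hcomm.pow_right k).eq, Module.End.mul_apply, h2, map_neg, ← Module.End.mul_apply,
      ← pow_succ, pow_succ]
    module

section Spans

variable (h₁ : IsTriad X₁ Y₁ Z₁) (h₂ : IsTriad X₂ Y₂ Z₂)
  (hα : IsHilbertBasis Y₁ Z₁ α) (hβ : IsHilbertBasis Y₂ Z₂ β)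
  {A₁ : Set (Fin p →₀ ℕ)} {A₂ : Set (Fin q →₀ ℕ)}
  (hA₁ : IsPreferred Y₁ α A₁) (hA₂ : IsPreferred Y₂ β A₂)

include h₁ h₂ hα hβ hA₁ hA₂

/-- Membership in the cone comes from the weights: a product occurring with weight below `s` in
either block would contradict `Sl2Ops.exists_poly_of_lt`. -/
theorem exists_leading_expansion {s : ℕ} {R : MvPolynomial (σ ⊕ τ) ℝ}
    (hR : polyD (blockDiag Y₁ Y₂) R = 0) (hs : (polyEnd (blockDiag Y₁ 0) ^ (s + 1)) R = 0) :
    ∃ c : A₁ × A₂ →₀ ℝ,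
      (c.sum fun i a => a • leadingProduct α β (i.1, i.2, s)) =
        (polyEnd (blockDiag Y₁ 0) ^ s) R ∧
      ∀ i ∈ c.support, ((i.1, i.2, s) : Vec p q) ∈ cone Z₁ Z₂ α β := by
  let G : A₁ × A₂ → MvPolynomial (σ ⊕ τ) ℝ := fun i => leadingProduct α β (i.1, i.2, s)
  have hG : LinearIndependent ℝ G :=
    linearIndependent_leadingProduct hA₁.linearIndependent hA₂.linearIndependent s
  have e₁ : polyD (blockDiag Y₁ 0) ((polyEnd (blockDiag Y₁ 0) ^ s) R) = 0 := by
    rw [pow_succ', Module.End.mul_apply] at hs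
    exact hs
  have e₂' : (polyEnd (blockDiag 0 Y₂) ^ (s + 1)) R = 0 := by
    rw [polyEnd_blockDiag_pow_eq hR, hs, smul_zero]
  have eqs := polyEnd_blockDiag_pow_eq hR s
  have e₂ : polyD (blockDiag 0 Y₂) ((polyEnd (blockDiag Y₁ 0) ^ s) R) = 0 := by
    rw [pow_succ', Module.End.mul_apply, eqs, map_smul] at e₂'
    exact (smul_eq_zero.1 e₂').resolve_left (pow_ne_zero _ (by norm_num))
  obtain ⟨c, hc⟩ := Finsupp.mem_span_range_iff_exists_finsupp.1
    (mem_span_of_polyD_eq_zero (fun a ha => hA₁.mem_span hα ha) (fun b hb => hA₂.mem_span hβ hb)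
      e₁ e₂)
  have hc' : (c.sum fun i a => a • G i) = (polyEnd (blockDiag Y₁ 0) ^ s) R := hc
  refine ⟨c, hc, fun i hi => ?_⟩
  rw [mem_cone_iff h₁ h₂ hα hβ]
  have hi := Finsupp.mem_support_iff.1 hi
  constructor
  · by_contra! hlt
    simp only at hlt
    -- Paired with the zero triad, the first triad acts on `x` alone, and `α^k β^ℓ` becomes an
    -- eigenvector with eigenvalue the weight of `α^k`.
    have ht := h₁.blockDiag (IsTriad.zero (σ := τ))
    obtain ⟨Q, hQ, hQ0⟩ := ht.sl2Ops.exists_poly_of_lt (s := s)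
      (w := (weight Z₁ (mono α i.1) : ℝ)) ht.exists_pow_polyD_eq_zero
      (by exact_mod_cast hlt) hs (exists_aeval_polyD_eq_zero _ R)
    refine hi (coeff_eq_zero_of_aeval_eq_zero hG
      (w := fun i => (weight Z₁ (mono α i.1) : ℝ)) (fun j => ?_) (by rw [hc']; exact hQ0) hQ)
    have := (isWeightInvariant_mono h₁ hα.weightInvariant j.1).1.polyD_weight h₁
    simp only [G, leadingProduct, Derivation.coeFn_coe, polyD_blockDiag_mul, this]
    simp
  · by_contra! hlt
    simp only at hlt
    have ht := (IsTriad.zero (σ := σ)).blockDiag h₂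
    obtain ⟨Q, hQ, hQ0⟩ := ht.sl2Ops.exists_poly_of_lt (s := s)
      (w := (weight Z₂ (mono β i.2) : ℝ)) ht.exists_pow_polyD_eq_zero
      (by exact_mod_cast hlt) e₂' (exists_aeval_polyD_eq_zero _ R)
    -- The second block sees the same leading term, up to the sign `(-1)^s`.
    rw [eqs, map_smul] at hQ0
    replace hQ0 := (smul_eq_zero.1 hQ0).resolve_left (pow_ne_zero _ (by norm_num))
    refine hi (coeff_eq_zero_of_aeval_eq_zero hG
      (w := fun i => (weight Z₂ (mono β i.2) : ℝ)) (fun j => ?_) (by rw [hc']; exact hQ0) hQ)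
    have := (isWeightInvariant_mono h₂ hβ.weightInvariant j.2).1.polyD_weight h₂
    simp only [G, leadingProduct, Derivation.coeFn_coe, polyD_blockDiag_mul, this]
    simp

theorem mem_span_mono_of_pow_eq_zero {t : ℕ} {θ : Fin t → MvPolynomial (σ ⊕ τ) ℝ}
    (hθ : ∀ v ∈ admissiblePart A₁ A₂ (cone Z₁ Z₂ α β),
      ∃ m : Fin t →₀ ℕ, HasLeading Y₁ Y₂ v.2.2 (leadingProduct α β v) (mono θ m))
    (s : ℕ) (R : MvPolynomial (σ ⊕ τ) ℝ) (hR : polyD (blockDiag Y₁ Y₂) R = 0)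
    (hs : (polyEnd (blockDiag Y₁ 0) ^ s) R = 0) :
    R ∈ Submodule.span ℝ (Set.range (mono θ)) := by
  induction s generalizing R with
  | zero => rw [show R = 0 by simpa using hs]; exact Submodule.zero_mem _
  | succ s ih =>
    obtain ⟨c, hc, hcone⟩ := exists_leading_expansion h₁ h₂ hα hβ hA₁ hA₂ hR hs
    have key : ∀ i : A₁ × A₂, ∃ P ∈ Submodule.span ℝ (Set.range (mono θ)),
        polyD (blockDiag Y₁ Y₂) P = 0 ∧ (polyEnd (blockDiag Y₁ 0) ^ s) P =
          c i • leadingProduct α β (i.1, i.2, s) := by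
      intro i
      by_cases hi : i ∈ c.support
      · obtain ⟨m, hm⟩ := hθ (i.1, i.2, s) ⟨hcone i hi, i.1.2, i.2.2⟩
        obtain ⟨d, hd, e⟩ := hm.pow
        refine ⟨(c i / d) • mono θ m,
          Submodule.smul_mem _ _ (Submodule.subset_span ⟨m, rfl⟩), ?_, ?_⟩
        · rw [Derivation.map_smul, hm.invariant, smul_zero]
        · rw [map_smul, e, smul_smul, div_mul_cancel₀ _ hd]
      · rw [Finsupp.notMem_support_iff.1 hi]
        exact ⟨0, Submodule.zero_mem _, by simp, by simp⟩
    choose P hP hP0 hPs using key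
    have hS : ∑ i ∈ c.support, P i ∈ Submodule.span ℝ (Set.range (mono θ)) :=
      Submodule.sum_mem _ fun i _ => hP i
    -- The correction has the same leading term as `R`, so the difference is an invariant already
    -- killed by `D₁^s`.
    have := ih (R - ∑ i ∈ c.support, P i)
      (by rw [map_sub, map_sum, hR, Finset.sum_eq_zero fun i _ => hP0 i, sub_zero])
      (by rw [map_sub, map_sum, ← hc, Finsupp.sum, sub_eq_zero]
          exact Finset.sum_congr rfl fun i _ => (hPs i).symm)
    simpa using Submodule.add_mem _ this hS

theorem mem_span_mono {t : ℕ} {θ : Fin t → MvPolynomial (σ ⊕ τ) ℝ}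
    (hθ : ∀ v ∈ admissiblePart A₁ A₂ (cone Z₁ Z₂ α β),
      ∃ m : Fin t →₀ ℕ, HasLeading Y₁ Y₂ v.2.2 (leadingProduct α β v) (mono θ m))
    (R : MvPolynomial (σ ⊕ τ) ℝ) (hR : polyD (blockDiag Y₁ Y₂) R = 0) :
    R ∈ Submodule.span ℝ (Set.range (mono θ)) := by
  -- Local nilpotency is available for the first matrix of a triad, so the roles of `X₁` and `Y₁`
  -- are exchanged.
  obtain ⟨s, hs⟩ := (h₁.symm.blockDiag (IsTriad.zero (σ := τ))).exists_pow_polyD_eq_zero R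
  exact mem_span_mono_of_pow_eq_zero h₁ h₂ hα hβ hA₁ hA₂ hθ s R hR hs

/-- Transvectants over different admissible elements of the cone are different. -/
theorem injOn_transvectantMap :
    Set.InjOn (transvectantMap X₁ Z₁ X₂ Z₂ α β) (admissiblePart A₁ A₂ (cone Z₁ Z₂ α β)) := by
  have hne : ∀ v : Vec p q, leadingProduct α β v ≠ 0 := fun v => mul_ne_zero
    ((map_ne_zero_iff _ (rename_injective _ Sum.inl_injective)).2
      (isWeightInvariant_mono h₁ hα.weightInvariant _).1.ne_zero)
    ((map_ne_zero_iff _ (rename_injective _ Sum.inr_injective)).2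
      (isWeightInvariant_mono h₂ hβ.weightInvariant _).1.ne_zero)
  have hle : ∀ v ∈ admissiblePart A₁ A₂ (cone Z₁ Z₂ α β),
      ∀ w ∈ admissiblePart A₁ A₂ (cone Z₁ Z₂ α β),
      transvectantMap X₁ Z₁ X₂ Z₂ α β v = transvectantMap X₁ Z₁ X₂ Z₂ α β w →
      v.2.2 ≤ w.2.2 := by
    intro v hv w hw e
    by_contra! hlt
    obtain ⟨c, hc, ec⟩ := (hasLeading_transvectantMap h₁ h₂ hα hβ hv.1).pow
    have h0 := (hasLeading_transvectantMap h₁ h₂ hα hβ hw.1).pow_succ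
    obtain ⟨d, hd⟩ := Nat.exists_eq_add_of_lt hlt
    rw [← e] at h0
    rw [hd, show w.2.2 + d + 1 = d + (w.2.2 + 1) by omega, pow_add, Module.End.mul_apply, h0,
      map_zero] at ec
    exact smul_ne_zero hc (hne v) ec.symm
  intro v hv w hw e
  -- The order recovers `s`; independence of the leading products then recovers `k` and `ℓ`.
  have es : v.2.2 = w.2.2 := le_antisymm (hle v hv w hw e) (hle w hw v hv e.symm)
  obtain ⟨c, hc, ec⟩ := (hasLeading_transvectantMap h₁ h₂ hα hβ hv.1).pow
  obtain ⟨d, hd, ed⟩ := (hasLeading_transvectantMap h₁ h₂ hα hβ hw.1).pow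
  rw [e, es, ed] at ec
  have hG := linearIndependent_leadingProduct hA₁.linearIndependent hA₂.linearIndependent v.2.2
  have hs := hG (a₁ := Finsupp.single (⟨w.1, hw.2.1⟩, ⟨w.2.1, hw.2.2⟩) d)
    (a₂ := Finsupp.single (⟨v.1, hv.2.1⟩, ⟨v.2.1, hv.2.2⟩) c) (by
      rw [Finsupp.linearCombination_single, Finsupp.linearCombination_single]
      exact ec)
  have hidx := (Finsupp.single_left_inj hd).1 (hs.trans (by
    rw [Finsupp.single_eq_single_iff] at hs
    rcases hs with ⟨-, h⟩ | ⟨h, -⟩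
    · rw [h]
    · exact absurd h hd))
  simp only [Prod.mk.injEq, Subtype.mk.injEq] at hidx
  exact Prod.ext hidx.1.symm (Prod.ext hidx.2.symm es)

theorem isHilbertBasis_transvectantMap {t : ℕ} {π : Fin t → Vec p q}
    (hπ : ∀ i, π i ∈ cone Z₁ Z₂ α β)
    (hspan : ∀ v ∈ admissiblePart A₁ A₂ (cone Z₁ Z₂ α β),
      v ∈ AddSubmonoid.closure (Set.range π)) :
    IsHilbertBasis (blockDiag Y₁ Y₂) (blockDiag Z₁ Z₂)
      (fun i => transvectantMap X₁ Z₁ X₂ Z₂ α β (π i)) := by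
  have hhom : ∀ i, ∃ d, (transvectantMap X₁ Z₁ X₂ Z₂ α β (π i)).IsHomogeneous d := by
    intro i
    choose δ hδ using hα.homogeneous
    choose ε hε using hβ.homogeneous
    exact ⟨_, transvectant_isHomogeneous (mono_isHomogeneous hδ _) (mono_isHomogeneous hε _)⟩
  refine ⟨fun i => ?_, hhom, fun f hf => ?_⟩
  · have hv := (mem_cone_iff h₁ h₂ hα hβ).1 (hπ i)
    exact isWeightInvariant_transvectant h₁ h₂
      (isWeightInvariant_mono h₁ hα.weightInvariant _).1
      (isWeightInvariant_mono h₂ hβ.weightInvariant _).1 hv.1 hv.2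
  · choose δ hδ using hhom
    have hmem := fun d => mem_span_mono h₁ h₂ hα hβ hA₁ hA₂ (fun v hv =>
      exists_mono_hasLeading (fun i => hasLeading_transvectantMap h₁ h₂ hα hβ (hπ i)) (hspan v hv))
      (formalComponent d f) (polyD_formalComponent hf d)
    simp only [Finsupp.mem_span_range_iff_exists_finsupp] at hmem
    choose c hc using hmem
    have hmono := mono_isHomogeneous hδ
    -- Each monomial takes its coefficient from the expansion of the component of its own degree, so
    -- the finite expansions glue without interfering.
    refine ⟨fun m => c (∑ i, δ i * m i) m, fun e => ?_⟩
    have hterm : ∀ m : Fin t →₀ ℕ,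
        c (∑ i, δ i * m i) m *
          coeff e (mono (fun i => transvectantMap X₁ Z₁ X₂ Z₂ α β (π i)) m) =
        c e.degree m * coeff e (mono (fun i => transvectantMap X₁ Z₁ X₂ Z₂ α β (π i)) m) := by
      intro m
      by_cases hm : e.degree = ∑ i, δ i * m i
      · rw [hm]
      · rw [MvPolynomial.IsHomogeneous.coeff_eq_zero (hmono m) hm, mul_zero, mul_zero]
    simp only [hterm]
    have hsub : (Function.support fun m => c e.degree m *
        coeff e (mono (fun i => transvectantMap X₁ Z₁ X₂ Z₂ α β (π i)) m)) ⊆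
        ((c e.degree).support : Set (Fin t →₀ ℕ)) := by
      intro m hm
      exact Finsupp.mem_support_iff.2 (left_ne_zero_of_mul hm)
    refine ⟨(Finset.finite_toSet _).subset hsub, ?_⟩
    rw [finsum_eq_sum_of_support_subset _ hsub, ← coeff_formalComponent f rfl, ← hc e.degree,
      Finsupp.sum, coeff_sum]
    simp

end Spans

end Main

end BoxProduct

theorem theorem11p7 {n m p q : ℕ}
    -- the two input triads
    (X₁ Y₁ Z₁ : Matrix (Fin n) (Fin n) ℝ) (X₂ Y₂ Z₂ : Matrix (Fin m) (Fin m) ℝ)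
    (h₁ : IsTriad X₁ Y₁ Z₁) (h₂ : IsTriad X₂ Y₂ Z₂)
    -- Hilbert bases of the two input algebras
    (α : Fin p → MvPolynomial (Fin n) ℝ) (β : Fin q → MvPolynomial (Fin m) ℝ)
    (hα : IsHilbertBasis Y₁ Z₁ α) (hβ : IsHilbertBasis Y₂ Z₂ β)
    -- standard preferred sets of monomials
    (A₁ : Set (Fin p →₀ ℕ)) (A₂ : Set (Fin q →₀ ℕ))
    (hA₁ : IsPreferred Y₁ α A₁) (hA₂ : IsPreferred Y₂ β A₂)
    (hs₁ : IsStandard A₁) (hs₂ : IsStandard A₂) :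
    -- the set of admissible primes is finite and is a weak spanning set for the admissible part
    (admissiblePart A₁ A₂ (primes (cone Z₁ Z₂ α β))).Finite ∧
    IsWeakSpanningSet (admissiblePart A₁ A₂ (primes (cone Z₁ Z₂ α β)))
      (admissiblePart A₁ A₂ (cone Z₁ Z₂ α β)) ∧
    -- for every enumeration of the admissible primes, the corresponding transvectants are distinct
    -- and form a Hilbert basis of the output algebra
    ∀ (t : ℕ) (π : Fin t → Vec p q), Function.Injective π →
      Set.range π = admissiblePart A₁ A₂ (primes (cone Z₁ Z₂ α β)) →
      Function.Injective (fun i => transvectantMap X₁ Z₁ X₂ Z₂ α β (π i)) ∧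
      IsHilbertBasis (blockDiag Y₁ Y₂) (blockDiag Z₁ Z₂)
        (fun i => transvectantMap X₁ Z₁ X₂ Z₂ α β (π i)) := by
  have hw := isWeakSpanningSet_admissiblePart (Z₁ := Z₁) (Z₂ := Z₂) (α := α) (β := β) hs₁ hs₂
  refine ⟨finite_primes_cone.subset fun v hv => hv.1, hw, fun t π hπ hr => ?_⟩
  have hmem : ∀ i, π i ∈ admissiblePart A₁ A₂ (cone Z₁ Z₂ α β) := fun i =>
    hw.1 (hr ▸ Set.mem_range_self i)
  refine ⟨fun i j hij => hπ (injOn_transvectantMap h₁ h₂ hα hβ hA₁ hA₂ (hmem i) (hmem j) hij),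
    isHilbertBasis_transvectantMap h₁ h₂ hα hβ hA₁ hA₂ (fun i => (hmem i).1) fun v hv => ?_⟩
  obtain ⟨s, hs, rfl⟩ := hw.2 v hv
  rw [← hr] at hs
  exact AddSubmonoid.multiset_sum_mem _ _ fun a ha => AddSubmonoid.subset_closure (hs a ha)
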